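/- Let $k$ be a field, $H$ a finite-dimensional Hopf algebra over $k$ with counit $\epsilon$, and $\Lambda\in H$ a left integral, i.e. $\Lambda\neq 0$ and $h\Lambda=\epsilon(h)\Lambda$ for all $h\in H$. Let $A$ be a left $H$-comodule algebra with coaction $\Delta_A:A\to H\otimes A$. For an $H$-module $V$ and an $A$-module $M$ the tensor product $V\otimes M=V\otimes_k M$ is an $A$-module via $\Delta_A$ (for $A=H$ it is the usual tensor product of $H$-modules). Let $H$-$\underline{\mathrm{mod}}$ be the quotient of the category of left $H$-modules by the morphisms that factor through an injective module, and let $A_H$-$\underline{\mathrm{mod}}$ be the quotient of the category of left $A$-modules by the morphisms that factor through a module $H\otimes N$, $N$ an $A$-module. In both, the shift is $TM=(H/k\Lambda)\otimes M$; the cone $C_u$ of a module map $u:X\to Y$ is the pushout of $u$ and $\Lambda\otimes\mathrm{id}:X\to H\otimes X$, which gives a standard triangle $X\to Y\to C_u\to TX$; and the distinguished triangles are the sextuples $X\to Y\to Z\to TX$ isomorphic in the quotient category to a standard triangle. The Grothendieck group has generators $[X]$ and relations $[Y]=[X]+[Z]$ for the distinguished triangles $X\to Y\to Z\to TX$. $K(H\text{-}\underline{\mathrm{mod}})$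 is formed with finite-dimensional $H$-modules, and $K(A_H\text{-}\underline{\mathrm{mod}})$ with the $A$-modules of an arbitrary fixed class $\mathcal P$ that is closed under finite direct sums, submodules and quotient modules, and $M\mapsto H\otimes M$. Then: 1. There are isomorphisms of $H$-modules $r_V:V\otimes H\to H\otimes V$, functorial in the $H$-module $V$, with $r_V\circ(\mathrm{id}\otimes\Lambda)=\Lambda\otimes\mathrm{id}$ as maps $V\to H\otimes V$. 2. For every $H$-module $V$, tensoring with $V$ descends to an exact functor on $A_H$-$\underline{\mathrm{mod}}$: the functor $V\otimes(-)$ on $A$-modules induces an additive functor on $A_H$-$\underline{\mathrm{mod}}$, and there is a natural isomorphism $\theta_X:V\otimes TX\to T(V\otimes X)$ such that for every distinguished triangle $X\xrightarrow{p}Y\xrightarrow{q}Z\xrightarrow{r}TX$ the sextuple $V\otimes X\xrightarrow{V\otimes p}V\otimes Y\xrightarrow{V\otimes q}V\otimes Z\xrightarrow{\theta_X\circ(V\otimes r)}T(V\otimes X)$ is a distinguished triangle. 3. The abelian group $K(H\text{-}\underline{\mathrm{mod}})$ is a ring with $[V][W]=[V\otimes W]$ and unit $[k]$ ($k$ the trivial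 module given by $\epsilon$), and for every class $\mathcal P$ as above $K(A_H\text{-}\underline{\mathrm{mod}})$ is a left module over this ring, with $V\otimes M\in\mathcal P$ and $[V]\cdot[M]=[V\otimes M]$ for every finite-dimensional $H$-module $V$ and every $M\in\mathcal P$. -/

import Mathlib

open CategoryTheory

universe u

namespace Hopfological

open scoped TensorProduct ModuleCat

noncomputable section

/-! ### Comodule algebras and the action of `H`-modules on `A`-modules -/

/-- A left `H`-comodule algebra over `k`: a `k`-algebra `A` with a `k`-algebra map
`Δ_A : A → H ⊗ A` such that `(ε ⊗ id) Δ_A = id` and `(Δ ⊗ id) Δ_A = (id ⊗ Δ_A) Δ_A`. -/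
class LeftComoduleAlgebra (k H A : Type u) [Field k] [Ring H] [HopfAlgebra k H]
    [Ring A] [Algebra k A] where
  /-- The coaction. -/
  coact : A →ₐ[k] H ⊗[k] A
  counit_coact : ∀ a : A,
    TensorProduct.lid k A ((Coalgebra.counit (R := k) (A := H)).rTensor A (coact a)) = a
  coassoc : ∀ a : A,
    TensorProduct.assoc k H H A ((Coalgebra.comul (R := k) (A := H)).rTensor A (coact a)) =
      coact.toLinearMap.lTensor H (coact a)

/-- `H` is a left comodule algebra over itself through its comultiplication. -/
instance LeftComoduleAlgebra.self (k H : Type u) [Field k] [Ring H] [HopfAlgebra k H] :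
    LeftComoduleAlgebra k H H where
  coact := Bialgebra.comulAlgHom k H
  counit_coact a := by simp
  coassoc a := by simp

section Tensor

variable (k : Type u) {H : Type u} {A : Type u} [Field k] [Ring H] [HopfAlgebra k H]
  [Ring A] [Algebra k A] [LeftComoduleAlgebra k H A]

/-- For `t = ∑ hᵢ ⊗ aᵢ` in `H ⊗ A`, the endomorphism `v ⊗ m ↦ ∑ hᵢ v ⊗ aᵢ m` of `V ⊗ M`. -/
def tensorActionAux (V : ModuleCat.{u} H) (M : ModuleCat.{u} A) :
    H ⊗[k] A →ₐ[k] Module.End k (V ⊗[k] M) :=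
  Module.endTensorEndAlgHom.comp
    (Algebra.TensorProduct.map (Algebra.lsmul k k (V : Type u)) (Algebra.lsmul k k (M : Type u)))

/-- The algebra map `A → H ⊗ A → End (V ⊗ M)`, for an `H`-module `V` and an `A`-module `M`. -/
def tensorAction (V : ModuleCat.{u} H) (M : ModuleCat.{u} A) :
    A →ₐ[k] Module.End k (V ⊗[k] M) :=
  (tensorActionAux k V M).comp (LeftComoduleAlgebra.coact (k := k) (H := H) (A := A))

/-- The `A`-module `V ⊗ M` (the tensor product is over `k`), on which `A` acts through `Δ_A`. For
`A = H` this is the tensor product of `H`-modules, with `H` acting through `Δ`. -/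
def tensorObj (V : ModuleCat.{u} H) (M : ModuleCat.{u} A) : ModuleCat.{u} A :=
  letI : Module A (V ⊗[k] M) := Module.compHom (V ⊗[k] M) (tensorAction k V M).toRingHom
  ModuleCat.of A (V ⊗[k] M)

variable {k} in
/-- The pure tensor `v ⊗ m`, as an element of the `A`-module `V ⊗ M`. -/
def tmul {V : ModuleCat.{u} H} {M : ModuleCat.{u} A} (v : V) (m : M) : tensorObj k V M :=
  (v ⊗ₜ[k] m : V ⊗[k] M)

theorem tensorObj_smul (V : ModuleCat.{u} H) (M : ModuleCat.{u} A) (a : A)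
    (x : tensorObj k V M) :
    a • x = tensorActionAux k V M (LeftComoduleAlgebra.coact (k := k) (H := H) a) x := rfl

variable {k} in
/-- If `Δ_A(a) = ∑ hᵢ ⊗ aᵢ` then `a (v ⊗ m) = ∑ hᵢ v ⊗ aᵢ m`. -/
theorem tensorObj_smul_tmul {V : ModuleCat.{u} H} {M : ModuleCat.{u} A} (a : A)
    {ι : Type*} (s : Finset ι) (h : ι → H) (b : ι → A)
    (hs : LeftComoduleAlgebra.coact (k := k) (H := H) a = ∑ i ∈ s, h i ⊗ₜ[k] b i)
    (v : V) (m : M) :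
    a • (tmul v m : tensorObj k V M) = ∑ i ∈ s, (tmul (h i • v) (b i • m) : tensorObj k V M) := by
  rw [tensorObj_smul, hs, map_sum]
  change (∑ i ∈ s, tensorActionAux k V M (h i ⊗ₜ[k] b i)) (v ⊗ₜ[k] m : V ⊗[k] M) = _
  rw [LinearMap.sum_apply]
  rfl

theorem tmul_add {V : ModuleCat.{u} H} {M : ModuleCat.{u} A} (v : V) (m m' : M) :
    (tmul v (m + m') : tensorObj k V M) = tmul v m + tmul v m' :=
  TensorProduct.tmul_add v m m'

theorem add_tmul {V : ModuleCat.{u} H} {M : ModuleCat.{u} A} (v v' : V) (m : M) :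
    (tmul (v + v') m : tensorObj k V M) = tmul v m + tmul v' m :=
  TensorProduct.add_tmul v v' m

theorem tmul_sum {V : ModuleCat.{u} H} {M : ModuleCat.{u} A} {ι : Type*} (s : Finset ι) (v : V)
    (m : ι → M) : (tmul v (∑ i ∈ s, m i) : tensorObj k V M) = ∑ i ∈ s, tmul v (m i) :=
  TensorProduct.tmul_sum v s m

theorem sum_tmul {V : ModuleCat.{u} H} {M : ModuleCat.{u} A} {ι : Type*} (s : Finset ι) (v : ι → V)
    (m : M) : (tmul (∑ i ∈ s, v i) m : tensorObj k V M) = ∑ i ∈ s, tmul (v i) m :=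
  TensorProduct.sum_tmul s v m

theorem zero_tmul {V : ModuleCat.{u} H} {M : ModuleCat.{u} A} (m : M) :
    (tmul (0 : V) m : tensorObj k V M) = 0 :=
  TensorProduct.zero_tmul _ m

theorem smul_tmul {V : ModuleCat.{u} H} {M : ModuleCat.{u} A} (c : k) (v : V) (m : M) :
    (tmul (algebraMap k H c • v) m : tensorObj k V M) = tmul v (algebraMap k A c • m) :=
  TensorProduct.smul_tmul c v m

/-- The `k`-linear map underlying a morphism of `A`-modules. -/
def kLin {A : Type u} [Ring A] [Algebra k A] {M N : ModuleCat.{u} A} (f : M ⟶ N) : M →ₗ[k] N :=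
  f.hom.restrictScalars k

theorem map_tensorActionAux {V V' : ModuleCat.{u} H} {M M' : ModuleCat.{u} A} (f : V ⟶ V')
    (g : M ⟶ M') (t : H ⊗[k] A) :
    TensorProduct.map (kLin k f) (kLin k g) ∘ₗ tensorActionAux k V M t =
      tensorActionAux k V' M' t ∘ₗ TensorProduct.map (kLin k f) (kLin k g) := by
  induction t using TensorProduct.induction_on with
  | zero => simp
  | add s t hs ht => rw [map_add, map_add, LinearMap.comp_add, LinearMap.add_comp, hs, ht]
  | tmul h b =>
    refine TensorProduct.ext' fun v m => ?_
    change f.hom (h • v) ⊗ₜ[k] g.hom (b • m) = (h • f.hom v) ⊗ₜ[k] (b • g.hom m)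
    rw [map_smul, map_smul]

/-- `f ⊗ g : V ⊗ M → V' ⊗ M'`. -/
def tensorHom {V V' : ModuleCat.{u} H} {M M' : ModuleCat.{u} A} (f : V ⟶ V') (g : M ⟶ M') :
    tensorObj k V M ⟶ tensorObj k V' M' :=
  ModuleCat.ofHom (R := A) (X := tensorObj k V M) (Y := tensorObj k V' M')
    { toFun := fun x => (TensorProduct.map (kLin k f) (kLin k g) (x : V ⊗[k] M) : V' ⊗[k] M')
      map_add' := fun x y => map_add (TensorProduct.map (kLin k f) (kLin k g)) x y
      map_smul' := fun a x =>
        LinearMap.congr_fun (map_tensorActionAux k f g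
          (LeftComoduleAlgebra.coact (k := k) (H := H) a)) x }

variable {k} in
theorem tensorHom_tmul {V V' : ModuleCat.{u} H} {M M' : ModuleCat.{u} A} (f : V ⟶ V')
    (g : M ⟶ M') (v : V) (m : M) :
    (tensorHom k f g).hom (tmul v m) = tmul (f.hom v) (g.hom m) := rfl

variable {k} in
/-- Two morphisms out of `V ⊗ M` that agree on pure tensors are equal. -/
theorem tensor_ext {V : ModuleCat.{u} H} {M N : ModuleCat.{u} A} {f g : tensorObj k V M ⟶ N}
    (h : ∀ (v : V) (m : M), f.hom (tmul v m) = g.hom (tmul v m)) : f = g := by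
  ext x
  refine TensorProduct.induction_on (motive := fun x : V ⊗[k] M => f.hom x = g.hom x) x ?_ h ?_
  · exact (map_zero f.hom).trans (map_zero g.hom).symm
  · intro x y hx hy
    exact (map_add f.hom _ _).trans ((congrArg₂ _ hx hy).trans (map_add g.hom _ _).symm)

/-- The endofunctor `M ↦ V ⊗ M` of `A`-modules. -/
def tensorFunctor (V : ModuleCat.{u} H) : ModuleCat.{u} A ⥤ ModuleCat.{u} A where
  obj M := tensorObj k V M
  map g := tensorHom k (𝟙 V) g
  map_id _ := tensor_ext fun _ _ => rfl
  map_comp _ _ := tensor_ext fun _ _ => rfl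

instance (V : ModuleCat.{u} H) : (tensorFunctor k V : ModuleCat.{u} A ⥤ ModuleCat.{u} A).Additive where
  map_add {_ _ f g} := tensor_ext fun v m => tmul_add k v (f.hom m) (g.hom m)

end Tensor

/-! ### Integrals, the shift and cones -/

section Integral

variable (k : Type u) {H : Type u} [Field k] [Ring H] [HopfAlgebra k H]

/-- `Λ` is a left integral of `H`: a nonzero element with `h Λ = ε(h) Λ` for all `h`. -/
structure IsLeftIntegral (Λ : H) : Prop where
  ne_zero : Λ ≠ 0
  mul_eq : ∀ h : H, h * Λ = Coalgebra.counit (R := k) h • Λ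

/-- The regular left `H`-module. -/
abbrev regular (H : Type u) [Ring H] : ModuleCat.{u} H := ModuleCat.of H H

/-- The one-dimensional `H`-module `k`, on which `H` acts through the counit. -/
def trivialModule (H : Type u) [Ring H] [HopfAlgebra k H] : ModuleCat.{u} H :=
  letI : Module H k := Module.compHom k (Bialgebra.counitAlgHom k H).toRingHom
  ModuleCat.of H k

/-- The `H`-module `H / kΛ`; for a left integral `Λ` the left ideal `HΛ` equals `kΛ`. -/
abbrev regularModIntegral (Λ : H) : ModuleCat.{u} H :=
  ModuleCat.of H (H ⧸ Submodule.span H {Λ})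

/-- The quotient map `H → H / kΛ`. -/
abbrev regularProj (Λ : H) : regular H ⟶ regularModIntegral Λ :=
  ModuleCat.ofHom (Submodule.span H {Λ}).mkQ

variable {A : Type u} [Ring A] [Algebra k A] [LeftComoduleAlgebra k H A]

/-- The inclusion of `A`-modules `Λ ⊗ id : M → H ⊗ M`. -/
def integralInclusion {Λ : H} (hΛ : IsLeftIntegral k Λ) (M : ModuleCat.{u} A) :
    M ⟶ tensorObj k (regular H) M :=
  ModuleCat.ofHom (R := A) (X := M) (Y := tensorObj k (regular H) M)
    { toFun := fun m => tmul (V := regular H) Λ m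
      map_add' := fun m m' => tmul_add k (V := regular H) Λ m m'
      map_smul' := fun a m => by
        obtain ⟨s, hs⟩ := TensorProduct.exists_finset
          (LeftComoduleAlgebra.coact (k := k) (H := H) a)
        have h1 := LeftComoduleAlgebra.counit_coact (k := k) (H := H) a
        rw [hs] at h1
        simp only [map_sum, LinearMap.rTensor_tmul, TensorProduct.lid_tmul] at h1
        rw [RingHom.id_apply, tensorObj_smul_tmul a s Prod.fst Prod.snd hs]
        conv_lhs => rw [← h1, Finset.sum_smul, tmul_sum]
        refine Finset.sum_congr rfl fun i _ => ?_
        rw [Algebra.smul_def, mul_smul, ← smul_tmul]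
        refine congrArg (fun z : H => tmul (V := regular H) z (i.2 • m)) ?_
        rw [smul_eq_mul, smul_eq_mul, hΛ.mul_eq i.1, Algebra.smul_def] }

/-- The inclusion of `H`-modules `id ⊗ Λ : V → V ⊗ H`. -/
def integralInclusionRight {Λ : H} (hΛ : IsLeftIntegral k Λ) (V : ModuleCat.{u} H) :
    V ⟶ tensorObj k V (regular H) :=
  ModuleCat.ofHom (R := H) (X := V) (Y := tensorObj k V (regular H))
    { toFun := fun v => tmul (M := regular H) v Λ
      map_add' := fun v v' => add_tmul k (M := regular H) v v' Λ
      map_smul' := fun a v => by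
        obtain ⟨s, hs⟩ := TensorProduct.exists_finset (Coalgebra.comul (R := k) a)
        have h1 := congrArg (TensorProduct.rid k H) (Coalgebra.lTensor_counit_comul (R := k) a)
        rw [hs] at h1
        simp only [map_sum, LinearMap.lTensor_tmul, TensorProduct.rid_tmul, one_smul] at h1
        rw [RingHom.id_apply, tensorObj_smul_tmul a s Prod.fst Prod.snd hs]
        conv_lhs => rw [← h1, Finset.sum_smul, sum_tmul]
        refine Finset.sum_congr rfl fun i _ => ?_
        rw [Algebra.smul_def, mul_smul, smul_tmul]
        refine congrArg (fun z : H => tmul (M := regular H) (i.1 • v) z) ?_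
        rw [smul_eq_mul, smul_eq_mul, hΛ.mul_eq i.2, Algebra.smul_def] }

/-- The shift functor `T M = (H / kΛ) ⊗ M` on `A`-modules. -/
def shift (A : Type u) [Ring A] [Algebra k A] [LeftComoduleAlgebra k H A] (Λ : H) :
    ModuleCat.{u} A ⥤ ModuleCat.{u} A :=
  tensorFunctor k (regularModIntegral Λ)

/-- The quotient map `H ⊗ M → T M`. -/
def shiftProj (Λ : H) (M : ModuleCat.{u} A) :
    tensorObj k (regular H) M ⟶ (shift k A Λ).obj M :=
  tensorHom k (regularProj Λ) (𝟙 M)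

theorem integralInclusion_shiftProj {Λ : H} (hΛ : IsLeftIntegral k Λ) (M : ModuleCat.{u} A) :
    integralInclusion k hΛ M ≫ shiftProj k Λ M = 0 := by
  ext m
  have h0 : (regularProj Λ).hom Λ = 0 :=
    (Submodule.Quotient.mk_eq_zero _).2 (Submodule.mem_span_singleton_self Λ)
  change (tmul ((regularProj Λ).hom Λ) m : tensorObj k (regularModIntegral Λ) M) = 0
  rw [h0]
  exact zero_tmul k m

/-- The cone of `f : X → Y`: the pushout of `f` and `Λ ⊗ id : X → H ⊗ X`. -/
def cone {Λ : H} (hΛ : IsLeftIntegral k Λ) {X Y : ModuleCat.{u} A} (f : X ⟶ Y) : ModuleCat.{u} A :=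
  Limits.pushout f (integralInclusion k hΛ X)

/-- The map `v : Y → C_f`. -/
def coneIn {Λ : H} (hΛ : IsLeftIntegral k Λ) {X Y : ModuleCat.{u} A} (f : X ⟶ Y) :
    Y ⟶ cone k hΛ f :=
  Limits.pushout.inl f (integralInclusion k hΛ X)

/-- The map `w : C_f → T X`, which vanishes on `Y` and is the quotient map on `H ⊗ X`. -/
def coneOut {Λ : H} (hΛ : IsLeftIntegral k Λ) {X Y : ModuleCat.{u} A} (f : X ⟶ Y) :
    cone k hΛ f ⟶ (shift k A Λ).obj X :=
  Limits.pushout.desc 0 (shiftProj k Λ X) (by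
    rw [Limits.comp_zero, integralInclusion_shiftProj])

end Integral

/-! ### Stable categories, distinguished triangles, Grothendieck groups -/

section Stable

variable {A : Type u} [Ring A]

/-- `f` factors through a module from the class `S`. -/
def FactorsThrough (S : ObjectProperty (ModuleCat.{u} A)) {M N : ModuleCat.{u} A} (f : M ⟶ N) :
    Prop :=
  ∃ P : ModuleCat.{u} A, S P ∧ ∃ (g₁ : M ⟶ P) (g₂ : P ⟶ N), g₁ ≫ g₂ = f

/-- Two morphisms are identified when their difference factors through a module from `S`. -/
def stableRel (S : ObjectProperty (ModuleCat.{u} A)) : HomRel (ModuleCat.{u} A) :=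
  fun _ _ f g => FactorsThrough S (f - g)

/-- The quotient of the category of `A`-modules by the morphisms that factor through a module
from `S`. -/
abbrev StableCat (S : ObjectProperty (ModuleCat.{u} A)) := CategoryTheory.Quotient (stableRel S)

/-- The quotient functor. -/
abbrev toStable (S : ObjectProperty (ModuleCat.{u} A)) : ModuleCat.{u} A ⥤ StableCat S :=
  CategoryTheory.Quotient.functor (stableRel S)

theorem stableRel_congruence (S : ObjectProperty (ModuleCat.{u} A))
    (h0 : ∀ M N : ModuleCat.{u} A, FactorsThrough S (0 : M ⟶ N))
    (hadd : ∀ (M N : ModuleCat.{u} A) (f g : M ⟶ N), FactorsThrough S f → FactorsThrough S g →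
      FactorsThrough S (f + g)) : Congruence (stableRel S) where
  comp_left := by
    rintro X Y Z f g g' ⟨P, hP, a, b, h⟩
    exact ⟨P, hP, f ≫ a, b, by rw [Category.assoc, h, Preadditive.comp_sub]⟩
  comp_right := by
    rintro X Y Z f f' g ⟨P, hP, a, b, h⟩
    exact ⟨P, hP, a, b ≫ g, by rw [← Category.assoc, h, Preadditive.sub_comp]⟩
  equivalence := by
    refine ⟨fun f => ?_, ?_, ?_⟩
    · change FactorsThrough S (f - f)
      rw [sub_self]; exact h0 _ _
    · rintro f g ⟨P, hP, a, b, h⟩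
      exact ⟨P, hP, a, -b, by rw [Preadditive.comp_neg, h, neg_sub]⟩
    · intro f g l h1 h2
      have := hadd _ _ _ _ h1 h2
      rwa [sub_add_sub_cancel] at this

variable (k : Type u) {H : Type u} [Field k] [Ring H] [HopfAlgebra k H] [Algebra k A]
  [LeftComoduleAlgebra k H A]

/-- The class of `A`-modules of the form `H ⊗ N`, for `A`-modules `N`. The morphisms that factor
through it are the null-homotopic ones. -/
def induced (H A : Type u) [Ring H] [HopfAlgebra k H] [Ring A] [Algebra k A]
    [LeftComoduleAlgebra k H A] : ObjectProperty (ModuleCat.{u} A) :=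
  fun P => ∃ N : ModuleCat.{u} A, Nonempty (P ≅ tensorObj k (regular H) N)

/-- The class of injective `H`-modules. -/
def injectives (H : Type u) [Ring H] : ObjectProperty (ModuleCat.{u} H) := fun P => Injective P

/-- The stable category `A_H-mod`: the quotient of `A`-modules by the null-homotopic morphisms. -/
abbrev StableA (H A : Type u) [Ring H] [HopfAlgebra k H] [Ring A] [Algebra k A]
    [LeftComoduleAlgebra k H A] := StableCat (induced k H A)

theorem induced_zero (M N : ModuleCat.{u} A) : FactorsThrough (induced k H A) (0 : M ⟶ N) :=
  ⟨tensorObj k (regular H) M, ⟨M, ⟨Iso.refl _⟩⟩, 0, 0, by simp⟩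

theorem induced_add (M N : ModuleCat.{u} A) (f g : M ⟶ N)
    (hf : FactorsThrough (induced k H A) f) (hg : FactorsThrough (induced k H A) g) :
    FactorsThrough (induced k H A) (f + g) := by
  obtain ⟨P, ⟨X, ⟨e⟩⟩, a, b, rfl⟩ := hf
  obtain ⟨P', ⟨X', ⟨e'⟩⟩, a', b', rfl⟩ := hg
  let F : ModuleCat.{u} A ⥤ ModuleCat.{u} A := tensorFunctor k (regular H)
  let i : P ≅ F.obj X := e
  let i' : P' ≅ F.obj X' := e'
  refine ⟨F.obj (X ⊞ X'), ⟨_, ⟨Iso.refl _⟩⟩,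
    a ≫ i.hom ≫ F.map Limits.biprod.inl + a' ≫ i'.hom ≫ F.map Limits.biprod.inr,
    F.map Limits.biprod.fst ≫ i.inv ≫ b + F.map Limits.biprod.snd ≫ i'.inv ≫ b', ?_⟩
  simp only [Preadditive.add_comp, Preadditive.comp_add, Category.assoc, ← F.map_comp_assoc,
    Limits.biprod.inl_fst, Limits.biprod.inl_snd, Limits.biprod.inr_fst, Limits.biprod.inr_snd,
    F.map_id, F.map_zero, Category.id_comp, Limits.zero_comp, Limits.comp_zero, add_zero, zero_add,
    Iso.hom_inv_id_assoc]

instance induced_congruence : Congruence (stableRel (induced k H A)) :=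
  stableRel_congruence _ (induced_zero k) (induced_add k)

/-- `A_H-mod` is a preadditive category, with the addition of morphisms of `A`-modules. -/
instance stablePreadditive : Preadditive (StableA k H A) :=
  CategoryTheory.Quotient.preadditive _ (by
    rintro X Y f₁ f₂ g₁ g₂ h1 h2
    have h := induced_add k _ _ _ _ h1 h2
    change FactorsThrough _ _
    rwa [add_sub_add_comm])

/-- Tensoring with `V` respects the identification of homotopic morphisms. -/
def TensorDescends (A : Type u) [Ring A] [Algebra k A] [LeftComoduleAlgebra k H A]
    (V : ModuleCat.{u} H) : Prop :=
  ∀ (M N : ModuleCat.{u} A) (f g : M ⟶ N), stableRel (induced k H A) f g →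
    (tensorFunctor k V ⋙ toStable (induced k H A)).map f =
      (tensorFunctor k V ⋙ toStable (induced k H A)).map g

/-- The functor `M ↦ V ⊗ M` on `A_H-mod`. -/
def stableTensor {V : ModuleCat.{u} H} (hV : TensorDescends k A V) :
    StableA k H A ⥤ StableA k H A :=
  CategoryTheory.Quotient.lift _ (tensorFunctor k V ⋙ toStable (induced k H A)) hV

/-- A sextuple `X → Y → Z → T X` in the stable category is a distinguished triangle if it is
isomorphic in the stable category to the standard triangle `X₀ → Y₀ → C_f → T X₀` of a morphism
`f` of modules. The isomorphism is `(a, b, c)`, given by representatives; the class of `T a` is the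
shift of the class of `a`. -/
def IsDistinguished {Λ : H} (hΛ : IsLeftIntegral k Λ) (S : ObjectProperty (ModuleCat.{u} A))
    {X Y Z : ModuleCat.{u} A}
    (p : (toStable S).obj X ⟶ (toStable S).obj Y) (q : (toStable S).obj Y ⟶ (toStable S).obj Z)
    (r : (toStable S).obj Z ⟶ (toStable S).obj ((shift k A Λ).obj X)) : Prop :=
  ∃ (X₀ Y₀ : ModuleCat.{u} A) (f : X₀ ⟶ Y₀) (a : X ⟶ X₀) (b : Y ⟶ Y₀) (c : Z ⟶ cone k hΛ f),
    IsIso ((toStable S).map a) ∧ IsIso ((toStable S).map b) ∧ IsIso ((toStable S).map c) ∧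
    p ≫ (toStable S).map b = (toStable S).map a ≫ (toStable S).map f ∧
    q ≫ (toStable S).map c = (toStable S).map b ≫ (toStable S).map (coneIn k hΛ f) ∧
    r ≫ (toStable S).map ((shift k A Λ).map a) =
      (toStable S).map c ≫ (toStable S).map (coneOut k hΛ f)

/-- The relations `[Y] = [X] + [Z]`, one for each distinguished triangle `X → Y → Z → T X` of the
stable category with vertices in the class `P`. -/
def triangleRelations {Λ : H} (hΛ : IsLeftIntegral k Λ) (S P : ObjectProperty (ModuleCat.{u} A)) :
    Set (FreeAbelianGroup P.FullSubcategory) :=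
  {t | ∃ (X Y Z : P.FullSubcategory) (p : (toStable S).obj X.obj ⟶ (toStable S).obj Y.obj)
    (q : (toStable S).obj Y.obj ⟶ (toStable S).obj Z.obj)
    (r : (toStable S).obj Z.obj ⟶ (toStable S).obj ((shift k A Λ).obj X.obj)),
    IsDistinguished k hΛ S p q r ∧
      t = FreeAbelianGroup.of Y - (FreeAbelianGroup.of X + FreeAbelianGroup.of Z)}

/-- The Grothendieck group of the stable category of modules from the class `P`. -/
def GrothendieckGroup {Λ : H} (hΛ : IsLeftIntegral k Λ) (S P : ObjectProperty (ModuleCat.{u} A)) :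
    Type (u + 1) :=
  FreeAbelianGroup P.FullSubcategory ⧸ AddSubgroup.closure (triangleRelations k hΛ S P)

instance grothendieckAddCommGroup {Λ : H} (hΛ : IsLeftIntegral k Λ)
    (S P : ObjectProperty (ModuleCat.{u} A)) : AddCommGroup (GrothendieckGroup k hΛ S P) :=
  QuotientAddGroup.Quotient.addCommGroup _

/-- The class `[M]` of a module `M` from the class `P`. -/
def cls {Λ : H} (hΛ : IsLeftIntegral k Λ) (S P : ObjectProperty (ModuleCat.{u} A))
    (M : P.FullSubcategory) : GrothendieckGroup k hΛ S P :=
  QuotientAddGroup.mk (FreeAbelianGroup.of M)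

/-- The class of `H`-modules of finite dimension over `k`. -/
def finDim (H : Type u) [Ring H] [HopfAlgebra k H] : ObjectProperty (ModuleCat.{u} H) :=
  fun V => FiniteDimensional k V

theorem finDim_trivialModule : finDim k H (trivialModule k H) := by
  change FiniteDimensional k (trivialModule k H)
  have : Function.Surjective
      (LinearMap.toSpanSingleton k (trivialModule k H) (1 : k)) := by
    intro x
    refine ⟨(x : k), ?_⟩
    have h : ∀ c : k, Bialgebra.counitAlgHom k H (algebraMap k H c) * (1 : k) = c := fun c => by
      rw [AlgHom.commutes, mul_one]; rfl
    exact h x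
  exact Module.Finite.of_surjective _ this

theorem finDim_tensorObj {V W : ModuleCat.{u} H} (hV : finDim k H V) (hW : finDim k H W) :
    finDim k H (tensorObj k V W) := by
  have : FiniteDimensional k V := hV
  have : FiniteDimensional k W := hW
  let e : V ⊗[k] W →ₗ[k] tensorObj k V W :=
    { toFun := fun x => x
      map_add' := fun _ _ => rfl
      map_smul' := fun c x => by
        change (c • x : V ⊗[k] W) = tensorAction k V W (algebraMap k H c) x
        rw [AlgHom.commutes]; rfl }
  exact Module.Finite.of_surjective e fun x => ⟨x, rfl⟩

/-- The Grothendieck group `K(H-mod)` of the stable category of finite-dimensional `H`-modules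
(modulo morphisms that factor through an injective module). -/
abbrev KH {Λ : H} (hΛ : IsLeftIntegral k Λ) : Type (u + 1) :=
  GrothendieckGroup k hΛ (injectives H) (finDim k H)

/-- The class in `K(H-mod)` of a finite-dimensional `H`-module. -/
abbrev clsH {Λ : H} (hΛ : IsLeftIntegral k Λ) (V : (finDim k H).FullSubcategory) : KH k hΛ :=
  cls k hΛ (injectives H) (finDim k H) V

/-- The Grothendieck group `K(A_H-mod)` formed with the `A`-modules from the class `P`. -/
abbrev KA {Λ : H} (hΛ : IsLeftIntegral k Λ) (P : ObjectProperty (ModuleCat.{u} A)) :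
    Type (u + 1) :=
  GrothendieckGroup k hΛ (induced k H A) P

/-- The class in `K(A_H-mod)` of an `A`-module from the class `P`. -/
abbrev clsA {Λ : H} (hΛ : IsLeftIntegral k Λ) (P : ObjectProperty (ModuleCat.{u} A))
    (M : P.FullSubcategory) : KA k hΛ P :=
  cls k hΛ (induced k H A) P M

end Stable

end

end Hopfological

open Hopfological

/-! Everything rests on one comparison. For an `H`-module `V` with underlying space `V₀`, both `H ⊗
V` and `V ⊗ H` are free on `V₀`: the maps `h ⊗ v ↦ ∑ h₁ ⊗ h₂v` and `h ⊗ v ↦ ∑ h₁v ⊗ h₂` from `H ⊗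
V₀` have inverses built from `S` and `S⁻¹` (`freeIsoLeft`, `freeIsoRight`). In these coordinates `Λ
⊗ v` becomes `∑ Λ₁ ⊗ S(Λ₂)v`, while `v ⊗ Λ` becomes `∑ Λ₂ ⊗ S⁻¹(Λ₁)v`. The two differ by right
multiplication by a unit `u` of `H` on the first factor (`IsLeftIntegral.exists_unit`), and
inserting this automorphism yields `r_V` (`swapIso`).

The unit comes from the Frobenius property of `H`. The map `f ↦ ∑ f(Λ₁)Λ₂` from `H*` to `H` is
bijective (`contractLeft_surjective`); the preimage `l` of `1` is a Frobenius form whose dual bases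
are read off from `Δ(Λ)`. Bijectivity of `S`, the Casimir identity and an explicit formula for `u`
follow.

For exactness, `r_V` and associativity give `V ⊗ (H ⊗ M) ≅ H ⊗ (V ⊗ M)`, compatible with the
inclusions of `V ⊗ M` through `Λ` (`tensorRegularIso`). Hence `V ⊗ -` preserves null-homotopic maps.
Being right exact, it also preserves the pushout defining a cone and the cokernel `T M` of `Λ ⊗ id`;
this supplies `θ` and maps standard triangles to standard triangles.

For the Grothendieck groups, modules `H ⊗ N` over `H` are injective, by averaging with the Casimir
element, and an injective `Q` is a summand of `H ⊗ Q`. The two ideals of morphisms therefore agree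
for `A = H` (`factorsThrough_injectives_iff`), and one construction of the pairing `[V], [M] ↦ [V ⊗
M]` gives both the product and the action. Associativity and the unit laws come from module
isomorphisms, which preserve classes (`cls_eq_of_iso`). The class `P` is stable under `V ⊗ -`
because `V` is a quotient of a finite sum of copies of `H` (`prop_tensorObj`). -/

namespace Hopfological

open scoped TensorProduct ModuleCat

noncomputable section

/-! ### Integrals of finite-dimensional Hopf algebras -/

section HopfAlgebra

open Coalgebra HopfAlgebra WithConv

variable {k : Type u} {H : Type u} [Field k] [Ring H] [HopfAlgebra k H]

/-- The inclusion `h ↦ h ⊗ 1`. -/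
abbrev inclLeft (k H : Type u) [Field k] [Ring H] [HopfAlgebra k H] : H →ₗ[k] H ⊗[k] H :=
  (Algebra.TensorProduct.includeLeft : H →ₐ[k] H ⊗[k] H).toLinearMap

/-- The inclusion `h ↦ 1 ⊗ h`. -/
abbrev inclRight (k H : Type u) [Field k] [Ring H] [HopfAlgebra k H] : H →ₗ[k] H ⊗[k] H :=
  (Algebra.TensorProduct.includeRight : H →ₐ[k] H ⊗[k] H).toLinearMap

/-- Factoring `Δ` in the convolution algebra `Hom(H, H ⊗ H)` turns the Sweedler identities below
into cancellations: composing an inclusion with `S` gives its convolution inverse. -/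
theorem inclLeft_conv_inclRight :
    toConv (inclLeft k H) * toConv (inclRight k H) = toConv (comul (R := k) (A := H)) := by
  ext x
  rw [(ℛ k x).convMul_apply]
  simpa using (ℛ k x).eq

/-- Convolution inverses are preserved by algebra maps. -/
theorem algHom_conv_eq_one {B C : Type*} [Ring B] [Algebra k B] [Ring C] [Algebra k C]
    (h : B →ₐ[k] C) {f g : H →ₗ[k] B} (hfg : toConv f * toConv g = 1) :
    toConv (h.toLinearMap ∘ₗ f) * toConv (h.toLinearMap ∘ₗ g) = 1 := by
  have := LinearMap.algHom_comp_convMul_distrib h (toConv f) (toConv g)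
  rw [hfg] at this
  apply WithConv.ofConv_injective
  rw [← this]
  ext x
  simp [LinearMap.convOne_def]

/-- Cancel the left inclusion from the factorization of `Δ`. In Sweedler notation: `∑ (S(h₁) ⊗
1)Δ(h₂) = 1 ⊗ h`. -/
theorem antipode_conv_comul :
    toConv (inclLeft k H ∘ₗ antipode k) * toConv (comul (R := k) (A := H)) =
      toConv (inclRight k H) := by
  rw [← inclLeft_conv_inclRight, ← mul_assoc]
  have := algHom_conv_eq_one (Algebra.TensorProduct.includeLeft : H →ₐ[k] H ⊗[k] H)
    (LinearMap.antipode_mul_id (R := k) (C := H))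
  rw [LinearMap.comp_id] at this
  rw [this, one_mul]

theorem comul_conv_antipode :
    toConv (comul (R := k) (A := H)) * toConv (inclRight k H ∘ₗ antipode k) =
      toConv (inclLeft k H) := by
  rw [← inclLeft_conv_inclRight, mul_assoc]
  have := algHom_conv_eq_one (Algebra.TensorProduct.includeRight : H →ₐ[k] H ⊗[k] H)
    (LinearMap.id_mul_antipode (R := k) (C := H))
  rw [LinearMap.comp_id] at this
  rw [this, mul_one]

/-- The map `x ↦ ∑ x₁ ⊗ S(x₂)`. -/
def comulAntipode (k H : Type u) [Field k] [Ring H] [HopfAlgebra k H] : H →ₗ[k] H ⊗[k] H :=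
  (antipode k).lTensor H ∘ₗ comul

theorem inclLeft_conv_antipode :
    toConv (inclLeft k H) * toConv (inclRight k H ∘ₗ antipode k) =
      toConv (comulAntipode k H) := by
  ext x
  rw [(ℛ k x).convMul_apply]
  conv_rhs => rw [comulAntipode, ofConv_toConv, LinearMap.comp_apply, ← (ℛ k x).eq]
  simp

theorem comulAntipode_conv :
    toConv (comulAntipode k H) * toConv (inclRight k H) = toConv (inclLeft k H) := by
  rw [← inclLeft_conv_antipode, mul_assoc]
  have := algHom_conv_eq_one (Algebra.TensorProduct.includeRight : H →ₐ[k] H ⊗[k] H)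
    (LinearMap.antipode_mul_id (R := k) (C := H))
  rw [LinearMap.comp_id] at this
  rw [this, mul_one]

/-- The linear map `x ↦ f(x)` into the opposite algebra. -/
abbrev opComp {B : Type*} [Ring B] [Algebra k B] (f : H →ₗ[k] B) : H →ₗ[k] Bᵐᵒᵖ :=
  (MulOpposite.opLinearEquiv k).toLinearMap ∘ₗ f

/-- The images of the two inclusions commute, so `Δ` factors in the same way after passing to the
opposite algebra. That is the setting for `S⁻¹`, which is the convolution inverse of the identity as
a map into `Hᵐᵒᵖ`. -/
theorem opComp_inclLeft_conv :
    toConv (opComp (inclLeft k H)) * toConv (opComp (inclRight k H)) =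
      toConv (opComp (comul (R := k) (A := H))) := by
  ext x
  rw [(ℛ k x).convMul_apply]
  apply MulOpposite.unop_injective
  simpa using (ℛ k x).eq

/-- `∑ Δ(x₁)(1 ⊗ S(x₂)) = x ⊗ 1`. -/
theorem sum_comul_mul_antipode {x : H} {ι : Type*} (R : Repr k x ι) :
    ∑ i ∈ R.index, comul (R.left i) * ((1 : H) ⊗ₜ[k] antipode k (R.right i)) =
      x ⊗ₜ[k] (1 : H) := by
  have h := congrArg (fun f => f x) (comul_conv_antipode (k := k) (H := H))
  simp only [R.convMul_apply] at h
  exact h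

/-- `∑ x₁ ⊗ S(x₂)x₃ = x ⊗ 1`. -/
theorem sum_comulAntipode_mul {x : H} {ι : Type*} (R : Repr k x ι) :
    ∑ i ∈ R.index, comulAntipode k H (R.left i) * ((1 : H) ⊗ₜ[k] R.right i) =
      x ⊗ₜ[k] (1 : H) := by
  have h := congrArg (fun f => f x) (comulAntipode_conv (k := k) (H := H))
  simp only [R.convMul_apply] at h
  exact h

variable {Λ : H}

theorem IsLeftIntegral.comul_mul (hΛ : IsLeftIntegral k Λ) (h : H) :
    comul (R := k) h * comul (R := k) Λ = counit (R := k) h • comul (R := k) Λ := by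
  rw [← Bialgebra.comul_mul, hΛ.mul_eq, map_smul]

/-- `∑ Λ₁ ⊗ hΛ₂ = ∑ S(h)Λ₁ ⊗ Λ₂`. -/
theorem IsLeftIntegral.right_mul (hΛ : IsLeftIntegral k Λ) (h : H) :
    ((1 : H) ⊗ₜ[k] h) * comul (R := k) Λ = (antipode k h ⊗ₜ[k] (1 : H)) * comul (R := k) Λ := by
  have h1 := congrArg (fun f => f h) (antipode_conv_comul (k := k) (H := H))
  simp only [(ℛ k h).convMul_apply] at h1
  have h2 : inclRight k H h = (1 : H) ⊗ₜ[k] h := rfl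
  have h4 : ∑ x ∈ (ℛ k h).index, counit (R := k) ((ℛ k h).right x) • (ℛ k h).left x = h := by
    have := congrArg (TensorProduct.rid k H) (sum_tmul_counit_eq (R := k) (ℛ k h))
    simpa only [map_sum, TensorProduct.rid_tmul, one_smul] using this
  rw [← h2]
  -- Replace `1 ⊗ h` by `∑ (S(h₁) ⊗ 1)Δ(h₂)`; each `Δ(h₂)` then acts on `Δ(Λ)` as the scalar
  -- `ε(h₂)`.
  refine (congrArg (· * comul (R := k) Λ) h1.symm).trans ?_
  simp only [Finset.sum_mul, mul_assoc]
  conv_rhs => rw [← h4]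
  rw [map_sum, TensorProduct.sum_tmul, Finset.sum_mul]
  refine Finset.sum_congr rfl fun i _ => ?_
  change (antipode k ((ℛ k h).left i) ⊗ₜ[k] (1 : H)) *
    (comul (R := k) ((ℛ k h).right i) * comul (R := k) Λ) = _
  rw [hΛ.comul_mul, map_smul, mul_smul_comm, ← TensorProduct.smul_tmul', smul_mul_assoc]

/-- The map `f ↦ ∑ f(Λ₁) Λ₂`. -/
def contractLeft (Λ : H) : Module.Dual k H →ₗ[k] H where
  toFun f := TensorProduct.lid k H (f.rTensor H (comul (R := k) Λ))
  map_add' f g := by simp [LinearMap.rTensor_add]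
  map_smul' c f := by simp [LinearMap.rTensor_smul]

theorem contractLeft_eq_sum {ι : Type*} (Λ : H) (R : Repr k Λ ι) (f : Module.Dual k H) :
    contractLeft Λ f = ∑ i ∈ R.index, f (R.left i) • R.right i := by
  change TensorProduct.lid k H (f.rTensor H (comul (R := k) Λ)) = _
  rw [← R.eq]
  simp

/-- Contract the first tensor factor of `right_mul` with `f`. In particular the range of
`contractLeft Λ` is a left ideal, so it is everything as soon as it contains `1`. -/
theorem IsLeftIntegral.mul_contractLeft (hΛ : IsLeftIntegral k Λ) (h : H) (f : Module.Dual k H) :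
    h * contractLeft Λ f = contractLeft Λ (f ∘ₗ LinearMap.mulLeft k (antipode k h)) := by
  have h1 := congrArg (fun t => TensorProduct.lid k H (f.rTensor H t)) (hΛ.right_mul h)
  rw [contractLeft_eq_sum Λ (ℛ k Λ), contractLeft_eq_sum Λ (ℛ k Λ)]
  rw [← (ℛ k Λ).eq] at h1
  simpa [Finset.mul_sum] using h1

variable [FiniteDimensional k H]

theorem IsLeftIntegral.contractLeft_surjective (hΛ : IsLeftIntegral k Λ) :
    Function.Surjective (contractLeft (k := k) Λ) := by
  suffices h1 : (1 : H) ∈ LinearMap.range (contractLeft (k := k) Λ) by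
    obtain ⟨f, hf⟩ := h1
    intro y
    exact ⟨_, by rw [← hΛ.mul_contractLeft y f, hf, mul_one]⟩
  obtain ⟨f, hf⟩ : ∃ f : Module.Dual k H, f Λ = 1 := by
    obtain ⟨f, hf⟩ := not_forall.1 (mt (Module.forall_dual_apply_eq_zero_iff k Λ).1 hΛ.ne_zero)
    exact ⟨(f Λ)⁻¹ • f, inv_mul_cancel₀ hf⟩
  -- Convolving `f(·)1` with `S` gives a map `g` with `∑ g(x₁)x₂ = f(x)1`; at `x = Λ` this reads `∑
  -- g(Λ₁)Λ₂ = 1`.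
  let f' : H →ₗ[k] H := Algebra.linearMap k H ∘ₗ f
  let g : H →ₗ[k] H := (toConv f' * toConv (antipode k)).ofConv
  have hg : toConv g * toConv LinearMap.id = toConv f' := by
    change toConv f' * toConv (antipode k) * toConv LinearMap.id = toConv f'
    rw [mul_assoc, LinearMap.antipode_mul_id, mul_one]
  have h1 : LinearMap.mul' k H (TensorProduct.map g LinearMap.id (comul (R := k) Λ)) = 1 := by
    have := congrArg (fun t => t Λ) hg
    refine this.trans ?_
    change algebraMap k H (f Λ) = 1
    rw [hf, map_one]
  let b := Module.finBasis k H
  have h2 : ∀ t : H ⊗[k] H,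
      t = ∑ j, b j ⊗ₜ[k] (TensorProduct.lid k H ((b.coord j).rTensor H t)) := by
    intro t
    induction t using TensorProduct.induction_on with
    | zero => simp
    | add x y hx hy =>
      conv_lhs => rw [hx, hy]
      simp only [map_add, TensorProduct.tmul_add, Finset.sum_add_distrib]
    | tmul x y =>
      conv_lhs => rw [← b.sum_repr x, TensorProduct.sum_tmul]
      simp [TensorProduct.smul_tmul]
  -- Expanding the first factor of `Δ(Λ)` in the basis `b` exhibits `1` as a sum of left multiples,
  -- by the `g(b j)`, of contractions of `Δ(Λ)`.
  rw [h2 (comul Λ), map_sum, map_sum] at h1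
  rw [← h1]
  refine Submodule.sum_mem _ fun j _ => ?_
  exact ⟨_, (hΛ.mul_contractLeft (g (b j)) (b.coord j)).symm⟩

theorem IsLeftIntegral.contractLeft_injective (hΛ : IsLeftIntegral k Λ) :
    Function.Injective (contractLeft (k := k) Λ) :=
  (LinearMap.injective_iff_surjective_of_finrank_eq_finrank
    (Subspace.dual_finrank_eq)).2 hΛ.contractLeft_surjective

theorem IsLeftIntegral.exists_form (hΛ : IsLeftIntegral k Λ) :
    ∃ l : Module.Dual k H, contractLeft Λ l = 1 := hΛ.contractLeft_surjective 1

/-- With `∑ l(Λ₁)Λ₂ = 1`, the contraction formula gives `h = ∑ l(S(h)Λ₁)Λ₂`, so `S(h) = 0` forces `h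
= 0`; finite dimension does the rest. -/
theorem IsLeftIntegral.antipode_bijective (hΛ : IsLeftIntegral k Λ) :
    Function.Bijective (antipode k (A := H)) := by
  obtain ⟨l, hl⟩ := hΛ.exists_form
  have : Function.Injective (antipode k (A := H)) := by
    refine (injective_iff_map_eq_zero _).2 fun h hh => ?_
    have := hΛ.mul_contractLeft h l
    rw [hl, mul_one, hh] at this
    rw [this]
    have : l ∘ₗ LinearMap.mulLeft k (0 : H) = 0 := by ext; simp
    rw [this, map_zero]
  exact ⟨this, LinearMap.injective_iff_surjective.1 this⟩

/-- The inverse of the antipode. -/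
def antipodeInv (hΛ : IsLeftIntegral k Λ) : H →ₗ[k] H :=
  (LinearEquiv.ofBijective (antipode k) hΛ.antipode_bijective).symm.toLinearMap

@[simp]
theorem antipode_antipodeInv (hΛ : IsLeftIntegral k Λ) (x : H) :
    antipode k (antipodeInv hΛ x) = x :=
  (LinearEquiv.ofBijective (antipode k) hΛ.antipode_bijective).apply_symm_apply x

@[simp]
theorem antipodeInv_antipode (hΛ : IsLeftIntegral k Λ) (x : H) :
    antipodeInv hΛ (antipode k x) = x :=
  (LinearEquiv.ofBijective (antipode k) hΛ.antipode_bijective).symm_apply_apply x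

/-- `∑ hΛ₁ ⊗ Λ₂ = ∑ Λ₁ ⊗ S⁻¹(h)Λ₂`. -/
theorem IsLeftIntegral.left_mul (hΛ : IsLeftIntegral k Λ) (h : H) :
    (h ⊗ₜ[k] (1 : H)) * comul (R := k) Λ =
      ((1 : H) ⊗ₜ[k] antipodeInv hΛ h) * comul (R := k) Λ := by
  rw [hΛ.right_mul, antipode_antipodeInv]

/-- The Casimir element `∑ Λ₁ ⊗ S(Λ₂)` satisfies `∑ hΛ₁ ⊗ S(Λ₂) = ∑ Λ₁ ⊗ S(Λ₂)h`. -/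
theorem IsLeftIntegral.casimir (hΛ : IsLeftIntegral k Λ) (h : H) :
    (h ⊗ₜ[k] (1 : H)) * comulAntipode k H Λ = comulAntipode k H Λ * ((1 : H) ⊗ₜ[k] h) := by
  have h1 := congrArg ((antipode k).lTensor H) (hΛ.left_mul h)
  change _ * (antipode k).lTensor H (comul Λ) = (antipode k).lTensor H (comul Λ) * _
  rw [← (ℛ k Λ).eq] at h1 ⊢
  simpa [Finset.mul_sum, Finset.sum_mul, antipode_mul_antidistrib] using h1

/-- For the form `l` with `∑ l(Λ₁)Λ₂ = 1`, also `∑ l(S(Λ₂)y)Λ₁ = y`. -/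
theorem IsLeftIntegral.sum_form_smul (hΛ : IsLeftIntegral k Λ) {l : Module.Dual k H}
    (hl : contractLeft Λ l = 1) {ι : Type*} (R : Repr k Λ ι) (y : H) :
    ∑ i ∈ R.index, l (antipode k (R.right i) * y) • R.left i = y := by
  rw [← sub_eq_zero, ← Module.forall_dual_apply_eq_zero_iff k]
  intro f
  -- Contracting `Δ(Λ)` with either side gives `contractLeft Λ f`, and contraction is injective.
  -- Evaluated at `y`, this is the required identity paired with `f`.
  have h1 : l ∘ₗ LinearMap.mulLeft k (antipode k (contractLeft Λ f)) = f := by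
    apply hΛ.contractLeft_injective
    rw [← hΛ.mul_contractLeft, hl, mul_one]
  have h2 := LinearMap.congr_fun h1 y
  rw [contractLeft_eq_sum Λ R] at h2
  simp only [map_sum, map_smul, LinearMap.comp_apply, LinearMap.mulLeft_apply, Finset.sum_mul,
    smul_mul_assoc, smul_eq_mul] at h2
  rw [map_sub, sub_eq_zero, ← h2, map_sum]
  refine Finset.sum_congr rfl fun i _ => ?_
  rw [map_smul, smul_eq_mul, mul_comm]

/-- The map `x ↦ ∑ x₂ ⊗ S⁻¹(x₁)`. -/
def comulAntipodeInv (hΛ : IsLeftIntegral k Λ) : H →ₗ[k] H ⊗[k] H :=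
  (TensorProduct.comm k H H).toLinearMap ∘ₗ (antipodeInv hΛ).rTensor H ∘ₗ comul

/-- A finite-dimensional Hopf algebra has a unit `u` with `∑ Λ₂u ⊗ S⁻¹(Λ₁) = ∑ Λ₁ ⊗ S(Λ₂)`. -/
theorem IsLeftIntegral.exists_unit (hΛ : IsLeftIntegral k Λ) : ∃ u : Hˣ,
    comulAntipodeInv hΛ Λ * ((u : H) ⊗ₜ[k] (1 : H)) =
      comulAntipode k H Λ := by
  obtain ⟨l, hl⟩ := hΛ.exists_form
  let R := ℛ k Λ
  -- This formula is chosen so that the Casimir identity moves a left factor `h` of `u` into the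
  -- argument of `l`, as `S(h)`.
  let u : H := ∑ j ∈ R.index, l (antipode k (antipode k (R.right j))) • R.left j
  have hu : ∀ h : H, h * u =
      ∑ j ∈ R.index, l (antipode k h * antipode k (antipode k (R.right j))) • R.left j := by
    intro h
    have h1 := congrArg (fun t => TensorProduct.rid k H ((l ∘ₗ antipode k).lTensor H t))
      (hΛ.casimir h)
    have h2 : comulAntipode k H Λ = ∑ i ∈ R.index, R.left i ⊗ₜ[k] antipode k (R.right i) := by
      rw [comulAntipode, LinearMap.comp_apply, ← R.eq]; simp
    simp only [h2] at h1
    simpa [u, Finset.mul_sum, Finset.sum_mul, antipode_mul_antidistrib] using h1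
  -- `∑ Λ₁ ⊗ Λ₂u = ∑ S²(Λ₂) ⊗ Λ₁`: expand each `Λ₂u` with a second copy of `Λ`, then sum over the
  -- first copy by `sum_form_smul`. Applying `S⁻¹` to the first factor and exchanging the factors
  -- gives the claim.
  have key : ∑ i ∈ R.index, R.left i ⊗ₜ[k] (R.right i * u) =
      ∑ j ∈ R.index, antipode k (antipode k (R.right j)) ⊗ₜ[k] R.left j := by
    simp only [hu, TensorProduct.tmul_sum]
    rw [Finset.sum_comm]
    refine Finset.sum_congr rfl fun j _ => ?_
    conv_rhs => rw [← hΛ.sum_form_smul hl R (antipode k (antipode k (R.right j)))]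
    simp only [TensorProduct.sum_tmul, TensorProduct.smul_tmul]
  have hw : ∃ w : H, w * u = 1 := by
    -- Contracting `key` with `l ∘ S⁻¹` leaves `∑ l(S(Λ₂))Λ₁` on the right, which is `1` by
    -- `sum_form_smul` at `y = 1`.
    refine ⟨∑ i ∈ R.index, l (antipodeInv hΛ (R.left i)) • R.right i, ?_⟩
    have h1 := congrArg
      (fun t => TensorProduct.lid k H ((l ∘ₗ antipodeInv hΛ).rTensor H t)) key
    have h2 := hΛ.sum_form_smul hl R 1
    simp only [mul_one] at h2
    simp only [map_sum, LinearMap.rTensor_tmul, LinearMap.comp_apply, TensorProduct.lid_tmul,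
      antipodeInv_antipode, h2] at h1
    rw [← h1, Finset.sum_mul]
    simp
  obtain ⟨w, hw⟩ := hw
  have hw' : u * w = 1 := by
    have h1 : Function.Surjective (LinearMap.mulRight k u) := fun y =>
      ⟨y * w, by rw [LinearMap.mulRight_apply, mul_assoc, hw, mul_one]⟩
    apply LinearMap.injective_iff_surjective.2 h1
    rw [LinearMap.mulRight_apply, LinearMap.mulRight_apply, mul_assoc, hw, mul_one, one_mul]
  refine ⟨⟨u, w, hw', hw⟩, ?_⟩
  have h3 := congrArg (fun t => TensorProduct.comm k H H ((antipodeInv hΛ).rTensor H t)) key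
  change TensorProduct.comm k H H ((antipodeInv hΛ).rTensor H (comul Λ)) * _ = _
  rw [comulAntipode, LinearMap.comp_apply, ← R.eq]
  simpa [Finset.sum_mul] using h3

/-- Applying the injective antihomomorphism `S` to `∑ x₂S⁻¹(x₁) = ε(x)1` turns it into the antipode
axiom `∑ x₁S(x₂) = ε(x)1`. -/
theorem opComp_antipodeInv_conv (hΛ : IsLeftIntegral k Λ) :
    toConv (opComp (antipodeInv hΛ)) * toConv (opComp (LinearMap.id : H →ₗ[k] H)) = 1 := by
  ext x
  rw [(ℛ k x).convMul_apply]
  apply MulOpposite.unop_injective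
  apply hΛ.antipode_bijective.1
  have h := sum_mul_antipode_eq_algebraMap_counit (R := k) (ℛ k x)
  simpa [antipode_mul_antidistrib, Algebra.algebraMap_eq_smul_one] using h

theorem opComp_conv_antipodeInv (hΛ : IsLeftIntegral k Λ) :
    toConv (opComp (LinearMap.id : H →ₗ[k] H)) * toConv (opComp (antipodeInv hΛ)) = 1 := by
  ext x
  rw [(ℛ k x).convMul_apply]
  apply MulOpposite.unop_injective
  apply hΛ.antipode_bijective.1
  have h := sum_antipode_mul_eq_algebraMap_counit (R := k) (ℛ k x)
  simpa [antipode_mul_antidistrib, Algebra.algebraMap_eq_smul_one] using h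

theorem opComp_conv_comul (hΛ : IsLeftIntegral k Λ) :
    toConv (opComp (inclLeft k H ∘ₗ antipodeInv hΛ)) * toConv (opComp (comul (R := k) (A := H))) =
      toConv (opComp (inclRight k H)) := by
  rw [← opComp_inclLeft_conv, ← mul_assoc]
  have := algHom_conv_eq_one
    (AlgHom.op (Algebra.TensorProduct.includeLeft : H →ₐ[k] H ⊗[k] H))
    (opComp_antipodeInv_conv hΛ)
  exact (congrArg (· * _) this).trans (one_mul _)

theorem opComp_inclRight_conv (hΛ : IsLeftIntegral k Λ) :
    toConv (opComp (inclRight k H ∘ₗ antipodeInv hΛ)) * toConv (opComp (inclLeft k H)) =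
      toConv (opComp (comulAntipodeInv hΛ)) := by
  ext x
  rw [(ℛ k x).convMul_apply]
  apply MulOpposite.unop_injective
  change _ = TensorProduct.comm k H H ((antipodeInv hΛ).rTensor H (comul x))
  rw [← (ℛ k x).eq]
  simp

theorem opComp_conv_comulAntipodeInv (hΛ : IsLeftIntegral k Λ) :
    toConv (opComp (inclRight k H)) * toConv (opComp (comulAntipodeInv hΛ)) =
      toConv (opComp (inclLeft k H)) := by
  rw [← opComp_inclRight_conv, ← mul_assoc]
  have := algHom_conv_eq_one
    (AlgHom.op (Algebra.TensorProduct.includeRight : H →ₐ[k] H ⊗[k] H))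
    (opComp_conv_antipodeInv hΛ)
  exact (congrArg (· * _) this).trans (one_mul _)

/-- `∑ Δ(x₂)(S⁻¹(x₁) ⊗ 1) = 1 ⊗ x`. -/
theorem sum_comul_mul_antipodeInv (hΛ : IsLeftIntegral k Λ) {x : H} {ι : Type*} (R : Repr k x ι) :
    ∑ i ∈ R.index, comul (R.right i) * (antipodeInv hΛ (R.left i) ⊗ₜ[k] (1 : H)) =
      (1 : H) ⊗ₜ[k] x := by
  have h := congrArg (fun f => (f x).unop) (opComp_conv_comul hΛ)
  simp only [R.convMul_apply, Finset.unop_sum] at h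
  exact h

/-- `∑ x₃ ⊗ S⁻¹(x₂)x₁ = x ⊗ 1`. -/
theorem sum_comulAntipodeInv_mul (hΛ : IsLeftIntegral k Λ) {x : H} {ι : Type*} (R : Repr k x ι) :
    ∑ i ∈ R.index, comulAntipodeInv hΛ (R.right i) * ((1 : H) ⊗ₜ[k] R.left i) =
      x ⊗ₜ[k] (1 : H) := by
  have h := congrArg (fun f => (f x).unop) (opComp_conv_comulAntipodeInv hΛ)
  simp only [R.convMul_apply, Finset.unop_sum] at h
  exact h

end HopfAlgebra

/-! ### Tensor products of modules -/

section Associator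

variable (k : Type u) {H : Type u} {A : Type u} [Field k] [Ring H] [HopfAlgebra k H]
  [Ring A] [Algebra k A]

/-- The orbit map `a ↦ a • m`, as a `k`-linear map. -/
abbrev orbitMap {M : ModuleCat.{u} A} (m : M) : A →ₗ[k] M :=
  (LinearMap.toSpanSingleton A M m).restrictScalars k

theorem tensorActionAux_tmul {V : ModuleCat.{u} H} {M : ModuleCat.{u} A} (t : H ⊗[k] A) (v : V)
    (m : M) : tensorActionAux k V M t (v ⊗ₜ[k] m) =
      TensorProduct.map (orbitMap k v) (orbitMap k m) t := by
  induction t using TensorProduct.induction_on with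
  | zero => simp
  | add s t hs ht => rw [map_add, map_add, LinearMap.add_apply, hs, ht]
  | tmul h a => rfl

variable [LeftComoduleAlgebra k H A]

/-- The identity, as a `k`-linear equivalence between the two `k`-structures on `V ⊗ M`. -/
def tensorEquiv (V : ModuleCat.{u} H) (M : ModuleCat.{u} A) :
    tensorObj k V M ≃ₗ[k] V ⊗[k] M where
  toFun x := x
  invFun x := x
  left_inv _ := rfl
  right_inv _ := rfl
  map_add' _ _ := rfl
  map_smul' c x := by
    let y : V ⊗[k] M := x
    change tensorAction k V M (algebraMap k A c) y = c • y
    rw [AlgHom.commutes]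
    rfl

/-- The linear map underlying the associator. -/
def assocLin (V W : ModuleCat.{u} H) (M : ModuleCat.{u} A) :
    (tensorObj k V W) ⊗[k] M ≃ₗ[k] V ⊗[k] (tensorObj k W M) :=
  TensorProduct.congr (tensorEquiv k V W) (LinearEquiv.refl k M) ≪≫ₗ
    TensorProduct.assoc k V W M ≪≫ₗ
      TensorProduct.congr (LinearEquiv.refl k V) (tensorEquiv k W M).symm

/-- The map `a ⊗ (b ⊗ c) ↦ a v ⊗ (b w ⊗ c m)`. -/
def orbitMap₃ {V W : ModuleCat.{u} H} {M : ModuleCat.{u} A} (v : V) (w : W) (m : M) :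
    H ⊗[k] (H ⊗[k] A) →ₗ[k] V ⊗[k] (tensorObj k W M) :=
  TensorProduct.map (orbitMap k v)
    ((tensorEquiv k W M).symm.toLinearMap ∘ₗ TensorProduct.map (orbitMap k w) (orbitMap k m))

/-- With `smul_assocLin_tmul`, this writes both sides of the linearity of the associator as the same
map `orbitMap₃`, applied to `(Δ ⊗ id)t` and `(id ⊗ Δ_A)t`. For `t = Δ_A(a)` these agree by
coassociativity. -/
theorem assocLin_smul_tmul {V W : ModuleCat.{u} H} {M : ModuleCat.{u} A} (v : V) (w : W) (m : M)
    (t : H ⊗[k] A) :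
    assocLin k V W M (tensorActionAux k (tensorObj k V W) M t
      ((tmul v w : tensorObj k V W) ⊗ₜ[k] m)) =
      orbitMap₃ k v w m (TensorProduct.assoc k H H A
        ((Coalgebra.comul (R := k) (A := H)).rTensor A t)) := by
  induction t using TensorProduct.induction_on with
  | zero => simp
  | add s t hs ht => rw [map_add, LinearMap.add_apply, map_add, hs, ht, map_add, map_add, map_add]
  | tmul h a =>
    -- `Δ(h)` is replaced by an arbitrary tensor `z`, so that it suffices to check pure tensors.
    have key : ∀ z : H ⊗[k] H,
        assocLin k V W M (((tensorEquiv k V W).symm (tensorActionAux k V W z (v ⊗ₜ[k] w))) ⊗ₜ[k]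
          (a • m)) = orbitMap₃ k v w m (TensorProduct.assoc k H H A (z ⊗ₜ[k] a)) := by
      intro z
      induction z using TensorProduct.induction_on with
      | zero => simp
      | add s t hs ht =>
        rw [map_add, LinearMap.add_apply, map_add, TensorProduct.add_tmul, map_add, hs, ht,
          TensorProduct.add_tmul, map_add, map_add]
      | tmul h b => rfl
    exact key (Coalgebra.comul (R := k) h)

theorem smul_assocLin_tmul {V W : ModuleCat.{u} H} {M : ModuleCat.{u} A} (v : V) (w : W) (m : M)
    (t : H ⊗[k] A) :
    tensorActionAux k V (tensorObj k W M) t (v ⊗ₜ[k] (tmul w m : tensorObj k W M)) =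
      orbitMap₃ k v w m ((LeftComoduleAlgebra.coact (k := k) (H := H) (A := A)).toLinearMap.lTensor
        H t) := by
  induction t using TensorProduct.induction_on with
  | zero => simp
  | add s t hs ht => rw [map_add, LinearMap.add_apply, hs, ht, map_add, map_add]
  | tmul h a =>
    change (h • v) ⊗ₜ[k] ((tensorEquiv k W M).symm (tensorActionAux k W M
      (LeftComoduleAlgebra.coact (k := k) (H := H) a) (w ⊗ₜ[k] m))) = _
    rw [tensorActionAux_tmul]
    rfl

theorem assocLin_smul (V W : ModuleCat.{u} H) (M : ModuleCat.{u} A) (a : A) :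
    (assocLin k V W M).toLinearMap ∘ₗ tensorAction k (tensorObj k V W) M a =
      tensorAction k V (tensorObj k W M) a ∘ₗ (assocLin k V W M).toLinearMap := by
  refine TensorProduct.ext' fun y m => ?_
  have key : ∀ y : V ⊗[k] W,
      assocLin k V W M (tensorAction k (tensorObj k V W) M a
        ((tensorEquiv k V W).symm y ⊗ₜ[k] m)) =
      tensorAction k V (tensorObj k W M) a
        (assocLin k V W M ((tensorEquiv k V W).symm y ⊗ₜ[k] m)) := by
    intro y
    induction y using TensorProduct.induction_on with
    | zero => simp
    | add s t hs ht => simp only [map_add, TensorProduct.add_tmul, hs, ht]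
    | tmul v w =>
      refine (assocLin_smul_tmul k v w m _).trans ?_
      exact (congrArg _ (LeftComoduleAlgebra.coassoc (k := k) (H := H) a)).trans
        (smul_assocLin_tmul k v w m _).symm
  exact key y

/-- The associativity isomorphism `(V ⊗ W) ⊗ M ≅ V ⊗ (W ⊗ M)` of `A`-modules. -/
def associator (V W : ModuleCat.{u} H) (M : ModuleCat.{u} A) :
    tensorObj k (tensorObj k V W) M ≅ tensorObj k V (tensorObj k W M) :=
  let e : tensorObj k (tensorObj k V W) M ≃ₗ[A] tensorObj k V (tensorObj k W M) :=
    { toFun := fun x => assocLin k V W M x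
      invFun := fun x => (assocLin k V W M).symm x
      left_inv := (assocLin k V W M).left_inv
      right_inv := (assocLin k V W M).right_inv
      map_add' := map_add (assocLin k V W M)
      map_smul' := fun a x => LinearMap.congr_fun (assocLin_smul k V W M a) x }
  { hom := ModuleCat.ofHom (R := A) (X := tensorObj k (tensorObj k V W) M)
      (Y := tensorObj k V (tensorObj k W M)) e.toLinearMap
    inv := ModuleCat.ofHom (R := A) (X := tensorObj k V (tensorObj k W M))
      (Y := tensorObj k (tensorObj k V W) M) e.symm.toLinearMap
    hom_inv_id := by ext x; exact e.symm_apply_apply x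
    inv_hom_id := by ext x; exact e.apply_symm_apply x }

variable {k} in
/-- Two morphisms out of `(V ⊗ W) ⊗ M` that agree on pure tensors are equal. -/
theorem tensor_ext₃ {V W : ModuleCat.{u} H} {M N : ModuleCat.{u} A}
    {f g : tensorObj k (tensorObj k V W) M ⟶ N}
    (h : ∀ (v : V) (w : W) (m : M), f.hom (tmul (tmul v w : tensorObj k V W) m) =
      g.hom (tmul (tmul v w : tensorObj k V W) m)) : f = g := by
  refine tensor_ext fun y m => ?_
  refine TensorProduct.induction_on (motive := fun y : V ⊗[k] W =>
    f.hom (tmul (y : tensorObj k V W) m) = g.hom (tmul (y : tensorObj k V W) m)) y ?_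
    (fun v w => h v w m) fun x y hx hy => ?_
  · have : (tmul (0 : tensorObj k V W) m : tensorObj k (tensorObj k V W) M) = 0 := zero_tmul k m
    exact (congrArg f.hom this).trans
      (((map_zero f.hom).trans (map_zero g.hom).symm).trans (congrArg g.hom this.symm))
  · have : (tmul ((x : tensorObj k V W) + y) m : tensorObj k (tensorObj k V W) M) =
      tmul (x : tensorObj k V W) m + tmul (y : tensorObj k V W) m := add_tmul k _ _ m
    refine (congrArg f.hom this).trans ?_
    refine Eq.trans ?_ (congrArg g.hom this.symm)
    rw [map_add, map_add]
    exact congrArg₂ _ hx hy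

theorem associator_naturality {V V' W W' : ModuleCat.{u} H} {M M' : ModuleCat.{u} A} (f : V ⟶ V')
    (g : W ⟶ W') (h : M ⟶ M') :
    tensorHom k (tensorHom k f g) h ≫ (associator k V' W' M').hom =
      (associator k V W M).hom ≫ tensorHom k f (tensorHom k g h) :=
  tensor_ext₃ fun _ _ _ => rfl

theorem associator_inv_naturality {V V' W W' : ModuleCat.{u} H} {M M' : ModuleCat.{u} A}
    (f : V ⟶ V') (g : W ⟶ W') (h : M ⟶ M') :
    tensorHom k f (tensorHom k g h) ≫ (associator k V' W' M').inv =
      (associator k V W M).inv ≫ tensorHom k (tensorHom k f g) h := by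
  rw [Iso.comp_inv_eq, Category.assoc, associator_naturality, Iso.inv_hom_id_assoc]

theorem tensorHom_comp {V V' V'' : ModuleCat.{u} H} {M M' M'' : ModuleCat.{u} A} (f : V ⟶ V')
    (f' : V' ⟶ V'') (g : M ⟶ M') (g' : M' ⟶ M'') :
    tensorHom k f g ≫ tensorHom k f' g' = tensorHom k (f ≫ f') (g ≫ g') :=
  tensor_ext fun _ _ => rfl

theorem tensorHom_comp_assoc {V V' V'' : ModuleCat.{u} H} {M M' M'' N : ModuleCat.{u} A}
    (f : V ⟶ V') (f' : V' ⟶ V'') (g : M ⟶ M') (g' : M' ⟶ M'') (h : tensorObj k V'' M'' ⟶ N) :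
    tensorHom k f g ≫ tensorHom k f' g' ≫ h = tensorHom k (f ≫ f') (g ≫ g') ≫ h := by
  rw [← Category.assoc, tensorHom_comp]

theorem tensorHom_id (V : ModuleCat.{u} H) (M : ModuleCat.{u} A) :
    tensorHom k (𝟙 V) (𝟙 M) = 𝟙 (tensorObj k V M) :=
  tensor_ext fun _ _ => rfl

/-- The tensor product of isomorphisms. -/
@[simps]
def tensorIso {V V' : ModuleCat.{u} H} {M M' : ModuleCat.{u} A} (e : V ≅ V') (i : M ≅ M') :
    tensorObj k V M ≅ tensorObj k V' M' where
  hom := tensorHom k e.hom i.hom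
  inv := tensorHom k e.inv i.inv
  hom_inv_id := by rw [tensorHom_comp, e.hom_inv_id, i.hom_inv_id, tensorHom_id]
  inv_hom_id := by rw [tensorHom_comp, e.inv_hom_id, i.inv_hom_id, tensorHom_id]

/-- The functor `V ↦ V ⊗ M` from `H`-modules to `A`-modules. -/
def tensorRightFunctor (H : Type u) [Ring H] [HopfAlgebra k H] [LeftComoduleAlgebra k H A]
    (M : ModuleCat.{u} A) : ModuleCat.{u} H ⥤ ModuleCat.{u} A where
  obj V := tensorObj k V M
  map f := tensorHom k f (𝟙 M)
  map_id _ := tensorHom_id k _ _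
  map_comp _ _ := tensor_ext fun _ _ => rfl

instance (M : ModuleCat.{u} A) : (tensorRightFunctor k H M).Additive where
  map_add {_ _ f g} := tensor_ext fun v m => add_tmul k (f.hom v) (g.hom v) m

instance (V : ModuleCat.{u} H) : Limits.PreservesFiniteColimits
    (tensorFunctor k V : ModuleCat.{u} A ⥤ ModuleCat.{u} A) := by
  refine ((Functor.preservesFiniteColimits_tfae _).out 0 3).1 fun S hS => ?_
  have hg := hS.moduleCat_surjective_g
  have hfg := (ShortComplex.ShortExact.moduleCat_exact_iff_function_exact S).1 hS.exact
  have h := lTensor_exact (V : Type u) (f := kLin k S.f) (g := kLin k S.g) hfg hg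
  have h' := LinearMap.lTensor_surjective (V : Type u) (g := kLin k S.g) hg
  exact ⟨(ShortComplex.ShortExact.moduleCat_exact_iff_function_exact _).2 h,
    (ModuleCat.epi_iff_surjective _).2 h'⟩

instance (M : ModuleCat.{u} A) : Limits.PreservesFiniteColimits (tensorRightFunctor k H M) := by
  refine ((Functor.preservesFiniteColimits_tfae _).out 0 3).1 fun S hS => ?_
  have hg := hS.moduleCat_surjective_g
  have hfg := (ShortComplex.ShortExact.moduleCat_exact_iff_function_exact S).1 hS.exact
  have h := rTensor_exact (M : Type u) (f := kLin k S.f) (g := kLin k S.g) hfg hg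
  have h' := LinearMap.rTensor_surjective (M : Type u) (g := kLin k S.g) hg
  exact ⟨(ShortComplex.ShortExact.moduleCat_exact_iff_function_exact _).2 h,
    (ModuleCat.epi_iff_surjective _).2 h'⟩

end Associator

/-! ### Free modules and the isomorphism `V ⊗ H ≅ H ⊗ V` -/

section Free

open Coalgebra HopfAlgebra

variable (k : Type u) {H : Type u} [Field k] [Ring H] [HopfAlgebra k H]

/-- The free `H`-module on the vector space underlying `V`. -/
abbrev freeObj (V : ModuleCat.{u} H) : ModuleCat.{u} H := ModuleCat.of H (H ⊗[k] V)

/-- The `H`-linear map `h ⊗ v ↦ h • g v`. -/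
def freeLift {V X : ModuleCat.{u} H} (g : V →ₗ[k] X) : H ⊗[k] V →ₗ[H] X where
  toFun := TensorProduct.lift ((Algebra.lsmul k k (X : Type u)).toLinearMap.compl₂ g)
  map_add' := map_add _
  map_smul' h x := by
    induction x using TensorProduct.induction_on with
    | zero => simp
    | add x y hx hy => rw [smul_add, map_add, hx, hy, map_add, smul_add]
    | tmul a v => exact mul_smul h a (g v)

/-- `v ↦ w ⊗ v`. -/
def tmulLeft {W : ModuleCat.{u} H} (V : ModuleCat.{u} H) (w : W) : V →ₗ[k] tensorObj k W V :=
  (tensorEquiv k W V).symm.toLinearMap ∘ₗ TensorProduct.mk k W V w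

/-- `v ↦ v ⊗ w`. -/
def tmulRight {W : ModuleCat.{u} H} (V : ModuleCat.{u} H) (w : W) : V →ₗ[k] tensorObj k V W :=
  (tensorEquiv k V W).symm.toLinearMap ∘ₗ (TensorProduct.mk k V W).flip w

/-- For `σ : H → H ⊗ H`, the bilinear map `(v, x) ↦ ∑ σ(x)' ⊗ σ(x)'' v`. -/
def orbitBilin (V : ModuleCat.{u} H) (σ : H →ₗ[k] H ⊗[k] H) : V →ₗ[k] H →ₗ[k] H ⊗[k] V :=
  LinearMap.lcomp k _ σ ∘ₗ LinearMap.lTensorHom H ∘ₗ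
    (Algebra.lsmul k k (V : Type u)).toLinearMap.flip

/-- Moves the action on `v` into `H ⊗ H`, where the antipode identities apply. -/
theorem lTensor_orbitMap_smul {V : ModuleCat.{u} H} (h : H) (v : V) (z : H ⊗[k] H) :
    (orbitMap k (h • v)).lTensor H z = (orbitMap k v).lTensor H (z * ((1 : H) ⊗ₜ[k] h)) := by
  induction z using TensorProduct.induction_on with
  | zero => simp
  | add x y hx hy => rw [map_add, hx, hy, add_mul, map_add]
  | tmul a b => simp [mul_smul]

/-- The additive map on `V ⊗ M` induced by a balanced biadditive map. -/
def tensorLiftAddHom {A : Type u} [Ring A] [Algebra k A] [LeftComoduleAlgebra k H A]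
    {V : ModuleCat.{u} H} {M : ModuleCat.{u} A} {N : Type*} [AddCommGroup N] (B : V →+ M →+ N)
    (hB : ∀ (c : k) (v : V) (m : M), B (algebraMap k H c • v) m = B v (algebraMap k A c • m)) :
    tensorObj k V M →+ N :=
  TensorProduct.liftAddHom (R := k) (M := V) (N := M) B hB

/-- The additive map `x ⊗ v ↦ ∑ σ(x)' ⊗ σ(x)'' v`. -/
def orbitLeft (V : ModuleCat.{u} H) (σ : H →ₗ[k] H ⊗[k] H) :
    tensorObj k (regular H) V →+ H ⊗[k] V :=
  tensorLiftAddHom k (V := regular H)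
    (LinearMap.toAddMonoidHom'.comp (orbitBilin k V σ).flip.toAddMonoidHom) fun c x v => by
      change (orbitBilin k V σ) v (algebraMap k H c * (x : H)) =
        (orbitBilin k V σ) (c • v) (x : H)
      rw [← Algebra.smul_def, map_smul, map_smul, LinearMap.smul_apply]

/-- The additive map `v ⊗ x ↦ ∑ σ(x)' ⊗ σ(x)'' v`. -/
def orbitRight (V : ModuleCat.{u} H) (σ : H →ₗ[k] H ⊗[k] H) :
    tensorObj k V (regular H) →+ H ⊗[k] V :=
  tensorLiftAddHom k (M := regular H)
    (LinearMap.toAddMonoidHom'.comp (orbitBilin k V σ).toAddMonoidHom) fun c v x => by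
      change (orbitBilin k V σ) (c • v) (x : H) =
        (orbitBilin k V σ) v (algebraMap k H c * (x : H))
      rw [← Algebra.smul_def, map_smul, map_smul, LinearMap.smul_apply]

theorem orbitLeft_tmul (V : ModuleCat.{u} H) (σ : H →ₗ[k] H ⊗[k] H) (x : H) (v : V) :
    orbitLeft k V σ (tmul (V := regular H) x v) = (orbitMap k v).lTensor H (σ x) := rfl

theorem orbitRight_tmul (V : ModuleCat.{u} H) (σ : H →ₗ[k] H ⊗[k] H) (x : H) (v : V) :
    orbitRight k V σ (tmul (M := regular H) v x) = (orbitMap k v).lTensor H (σ x) := rfl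

theorem smul_tmul_self {V W : ModuleCat.{u} H} {x : H} {ι : Type*} (R : Repr k x ι) (v : V)
    (w : W) : x • (tmul v w : tensorObj k V W) =
      ∑ i ∈ R.index, (tmul (R.left i • v) (R.right i • w) : tensorObj k V W) :=
  tensorObj_smul_tmul x R.index R.left R.right R.eq.symm v w

theorem comulAntipode_eq_sum {x : H} {ι : Type*} (R : Repr k x ι) :
    comulAntipode k H x = ∑ i ∈ R.index, R.left i ⊗ₜ[k] antipode k (R.right i) := by
  rw [comulAntipode, LinearMap.comp_apply, ← R.eq]; simp

variable {k} in
/-- An additive map on `V ⊗ M` is determined by its values on pure tensors. -/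
theorem tensor_addHom_ext {A : Type u} [Ring A] [Algebra k A] [LeftComoduleAlgebra k H A]
    {V : ModuleCat.{u} H} {M : ModuleCat.{u} A} {N : Type*}
    [AddCommGroup N] {f g : tensorObj k V M →+ N}
    (h : ∀ (v : V) (m : M), f (tmul v m) = g (tmul v m)) (x : tensorObj k V M) : f x = g x := by
  refine TensorProduct.induction_on (motive := fun x : V ⊗[k] M => f x = g x) x ?_ h ?_
  · exact (map_zero f).trans (map_zero g).symm
  · intro x y hx hy
    exact (map_add f _ _).trans ((congrArg₂ _ hx hy).trans (map_add g _ _).symm)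

/-- The composite sends `h ⊗ v` to `∑ h₁ ⊗ S(h₂)h₃v`, which collapses to `h ⊗ v`. -/
theorem orbitLeft_freeLift (V : ModuleCat.{u} H) (x : H ⊗[k] V) :
    orbitLeft k V (comulAntipode k H) (freeLift k (tmulLeft (W := regular H) k V (1 : H)) x) = x := by
  induction x using TensorProduct.induction_on with
  | zero => simp
  | add x y hx hy => rw [map_add, map_add, hx, hy]
  | tmul h v =>
    let R := ℛ k h
    have h1 : freeLift k (tmulLeft (W := regular H) k V (1 : H)) (h ⊗ₜ[k] v) =
        ∑ i ∈ R.index, (tmul (V := regular H) (R.left i • (1 : H)) (R.right i • v)) :=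
      smul_tmul_self (V := regular H) k R (1 : H) v
    rw [h1, map_sum]
    simp only [orbitLeft_tmul, lTensor_orbitMap_smul, smul_eq_mul, mul_one]
    rw [← map_sum, sum_comulAntipode_mul]
    simp

theorem freeLift_tmulLeft {W V : ModuleCat.{u} H} (w : W) (v : V) (a b : H) :
    freeLift k (tmulLeft k V w) ((orbitMap k v).lTensor H (a ⊗ₜ[k] b)) =
      (tensorEquiv k W V).symm (TensorProduct.map (orbitMap k w) (orbitMap k v)
        (comul a * ((1 : H) ⊗ₜ[k] b))) := by
  refine (congrArg (tensorEquiv k W V).symm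
    (tensorActionAux_tmul k (comul a) w (b • v))).trans ?_
  refine congrArg (tensorEquiv k W V).symm ?_
  generalize comul (R := k) a = z
  induction z using TensorProduct.induction_on with
  | zero => simp
  | add x y hx hy => rw [map_add, hx, hy, add_mul, map_add]
  | tmul a b => simp [mul_smul]

/-- This is `∑ Δ(x₁)(1 ⊗ S(x₂)) = x ⊗ 1` applied to `w ⊗ v`; for `W = H` and `w = 1` it gives the
other inverse law. -/
theorem freeLift_comulAntipode {W V : ModuleCat.{u} H} (w : W) (v : V) (x : H) :
    freeLift k (tmulLeft k V w) ((orbitMap k v).lTensor H (comulAntipode k H x)) =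
      tmul (x • w) v := by
  let R := ℛ k x
  rw [comulAntipode_eq_sum k R, map_sum, map_sum]
  simp only [freeLift_tmulLeft]
  rw [← map_sum, ← map_sum, sum_comul_mul_antipode]
  change tmul (x • w) ((1 : H) • v) = _
  rw [one_smul]

theorem freeLift_orbitLeft (V : ModuleCat.{u} H) (x : tensorObj k (regular H) V) :
    freeLift k (tmulLeft (W := regular H) k V (1 : H)) (orbitLeft k V (comulAntipode k H) x) =
      x := by
  refine tensor_addHom_ext (f := (freeLift k (tmulLeft (W := regular H) k V
    (1 : H))).toAddMonoidHom.comp (orbitLeft k V (comulAntipode k H)))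
    (g := AddMonoidHom.id _) (fun y v => ?_) x
  refine (freeLift_comulAntipode (W := regular H) k (1 : H) v y).trans ?_
  exact congrArg (fun z : H => tmul (V := regular H) z v) (mul_one (y : H))

/-- The isomorphism `H ⊗ V₀ ≅ H ⊗ V`, `h ⊗ v ↦ ∑ h₁ ⊗ h₂v`. -/
def freeIsoLeft (V : ModuleCat.{u} H) : freeObj k V ≅ tensorObj k (regular H) V :=
  let e : H ⊗[k] V ≃ₗ[H] tensorObj k (regular H) V :=
    { freeLift k (tmulLeft (W := regular H) k V (1 : H)) with
      invFun := orbitLeft k V (comulAntipode k H)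
      left_inv := orbitLeft_freeLift k V
      right_inv := freeLift_orbitLeft k V }
  { hom := ModuleCat.ofHom (R := H) (X := H ⊗[k] V) (Y := tensorObj k (regular H) V) e.toLinearMap
    inv := ModuleCat.ofHom (R := H) (X := tensorObj k (regular H) V) (Y := H ⊗[k] V)
      e.symm.toLinearMap
    hom_inv_id := by
      exact ModuleCat.hom_ext (LinearMap.ext fun x => e.symm_apply_apply x)
    inv_hom_id := by
      exact ModuleCat.hom_ext (LinearMap.ext fun x => e.apply_symm_apply x) }

variable {k}

/-- The map `freeObj V → freeObj W` induced by a linear map. -/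
def freeMap {V W : ModuleCat.{u} H} (f : V ⟶ W) : freeObj k V ⟶ freeObj k W :=
  ModuleCat.ofHom (TensorProduct.AlgebraTensorModule.map (LinearMap.id : H →ₗ[H] H) (kLin k f))

theorem freeIsoLeft_naturality {V W : ModuleCat.{u} H} (f : V ⟶ W) :
    freeMap (k := k) f ≫ (freeIsoLeft k W).hom =
      (freeIsoLeft k V).hom ≫ tensorHom k (𝟙 (regular H)) f := by
  refine ModuleCat.hom_ext (LinearMap.ext fun x => ?_)
  induction x using TensorProduct.induction_on with
  | zero => simp
  | add x y hx hy => rw [map_add, hx, hy, map_add]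
  | tmul h v =>
    change h • (tmul (V := regular H) (1 : H) (f.hom v) : tensorObj k (regular H) W) =
      (tensorHom k (𝟙 (regular H)) f).hom (h • (tmul (V := regular H) (1 : H) v))
    rw [map_smul]
    rfl

/-- Right multiplication by a unit, as an automorphism of the regular module. -/
def mulRightUnit (u : Hˣ) : H ≃ₗ[H] H where
  toFun x := x * u
  invFun x := x * ↑u⁻¹
  left_inv x := by simp
  right_inv x := by simp
  map_add' x y := add_mul x y _
  map_smul' a x := mul_assoc a x _

/-- The automorphism `h ⊗ v ↦ hu ⊗ v`. -/
def freeUnitIso (u : Hˣ) (V : ModuleCat.{u} H) : freeObj k V ≅ freeObj k V :=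
  (TensorProduct.AlgebraTensorModule.congr (mulRightUnit u) (LinearEquiv.refl k V)).toModuleIso

theorem freeUnitIso_naturality (u : Hˣ) {V W : ModuleCat.{u} H} (f : V ⟶ W) :
    freeMap (k := k) f ≫ (freeUnitIso u W).hom = (freeUnitIso u V).hom ≫ freeMap f := by
  refine ModuleCat.hom_ext (LinearMap.ext fun x => ?_)
  induction x using TensorProduct.induction_on with
  | zero => simp
  | add x y hx hy => rw [map_add, hx, hy, map_add]
  | tmul h v => rfl

theorem freeUnitIso_lTensor (u : Hˣ) {V : ModuleCat.{u} H} (v : V) (z : H ⊗[k] H) :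
    (freeUnitIso u V).hom.hom ((orbitMap k v).lTensor H z) =
      (orbitMap k v).lTensor H (z * ((u : H) ⊗ₜ[k] (1 : H))) := by
  induction z using TensorProduct.induction_on with
  | zero => simp
  | add x y hx hy => rw [map_add, map_add, hx, hy, add_mul, map_add]
  | tmul h b =>
    rw [Algebra.TensorProduct.tmul_mul_tmul, mul_one]
    rfl

theorem freeLift_tmulRight {W V : ModuleCat.{u} H} (w : W) (v : V) (a b : H) :
    freeLift k (tmulRight k V w) ((orbitMap k v).lTensor H (a ⊗ₜ[k] b)) =
      (tensorEquiv k V W).symm (TensorProduct.map (orbitMap k v) (orbitMap k w)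
        (comul a * (b ⊗ₜ[k] (1 : H)))) := by
  refine (congrArg (tensorEquiv k V W).symm
    (tensorActionAux_tmul k (comul a) (b • v) w)).trans ?_
  refine congrArg (tensorEquiv k V W).symm ?_
  generalize comul (R := k) a = z
  induction z using TensorProduct.induction_on with
  | zero => simp
  | add x y hx hy => rw [map_add, hx, hy, add_mul, map_add]
  | tmul a b => simp [mul_smul]

variable [FiniteDimensional k H] {Λ : H} (hΛ : IsLeftIntegral k Λ)

/-- Mirror image of `orbitLeft_freeLift`: here `∑ h₃ ⊗ S⁻¹(h₂)h₁v` collapses to `h ⊗ v`.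
Invertibility of `S`, hence the integral, enters only on this side. -/
theorem orbitRight_freeLift (V : ModuleCat.{u} H) (x : H ⊗[k] V) :
    orbitRight k V (comulAntipodeInv hΛ) (freeLift k (tmulRight (W := regular H) k V (1 : H)) x) = x := by
  induction x using TensorProduct.induction_on with
  | zero => simp
  | add x y hx hy => rw [map_add, map_add, hx, hy]
  | tmul h v =>
    let R := ℛ k h
    have h1 : freeLift k (tmulRight (W := regular H) k V (1 : H)) (h ⊗ₜ[k] v) =
        ∑ i ∈ R.index, (tmul (M := regular H) (R.left i • v) (R.right i • (1 : H))) :=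
      smul_tmul_self (W := regular H) k R v (1 : H)
    rw [h1, map_sum]
    simp only [orbitRight_tmul, lTensor_orbitMap_smul, smul_eq_mul, mul_one]
    rw [← map_sum, sum_comulAntipodeInv_mul]
    simp

theorem comulAntipodeInv_eq_sum {x : H} {ι : Type*} (R : Repr k x ι) :
    comulAntipodeInv hΛ x = ∑ i ∈ R.index, R.right i ⊗ₜ[k] antipodeInv hΛ (R.left i) := by
  change TensorProduct.comm k H H ((antipodeInv hΛ).rTensor H (comul x)) = _
  rw [← R.eq]; simp

theorem freeLift_comulAntipodeInv {W V : ModuleCat.{u} H} (w : W) (v : V) (x : H) :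
    freeLift k (tmulRight k V w) ((orbitMap k v).lTensor H (comulAntipodeInv hΛ x)) =
      tmul v (x • w) := by
  let R := ℛ k x
  rw [comulAntipodeInv_eq_sum hΛ R, map_sum, map_sum]
  simp only [freeLift_tmulRight]
  rw [← map_sum, ← map_sum, sum_comul_mul_antipodeInv]
  change tmul ((1 : H) • v) (x • w) = _
  rw [one_smul]

theorem freeLift_orbitRight (V : ModuleCat.{u} H) (x : tensorObj k V (regular H)) :
    freeLift k (tmulRight (W := regular H) k V (1 : H))
      (orbitRight k V (comulAntipodeInv hΛ) x) = x := by
  refine tensor_addHom_ext (f := (freeLift k (tmulRight (W := regular H) k V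
    (1 : H))).toAddMonoidHom.comp (orbitRight k V (comulAntipodeInv hΛ)))
    (g := AddMonoidHom.id _) (fun v y => ?_) x
  refine (freeLift_comulAntipodeInv hΛ (W := regular H) (1 : H) v y).trans ?_
  exact congrArg (fun z : H => tmul (M := regular H) v z) (mul_one (y : H))

/-- The isomorphism `H ⊗ V₀ ≅ V ⊗ H`, `h ⊗ v ↦ ∑ h₁v ⊗ h₂`. -/
def freeIsoRight (V : ModuleCat.{u} H) : freeObj k V ≅ tensorObj k V (regular H) :=
  let e : H ⊗[k] V ≃ₗ[H] tensorObj k V (regular H) :=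
    { freeLift k (tmulRight (W := regular H) k V (1 : H)) with
      invFun := orbitRight k V (comulAntipodeInv hΛ)
      left_inv := orbitRight_freeLift hΛ V
      right_inv := freeLift_orbitRight hΛ V }
  { hom := ModuleCat.ofHom (R := H) (X := H ⊗[k] V) (Y := tensorObj k V (regular H)) e.toLinearMap
    inv := ModuleCat.ofHom (R := H) (X := tensorObj k V (regular H)) (Y := H ⊗[k] V)
      e.symm.toLinearMap
    hom_inv_id := by
      exact ModuleCat.hom_ext (LinearMap.ext fun x => e.symm_apply_apply x)
    inv_hom_id := by
      exact ModuleCat.hom_ext (LinearMap.ext fun x => e.apply_symm_apply x) }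

theorem freeIsoRight_naturality {V W : ModuleCat.{u} H} (f : V ⟶ W) :
    freeMap (k := k) f ≫ (freeIsoRight hΛ W).hom =
      (freeIsoRight hΛ V).hom ≫ tensorHom k f (𝟙 (regular H)) := by
  refine ModuleCat.hom_ext (LinearMap.ext fun x => ?_)
  induction x using TensorProduct.induction_on with
  | zero => simp
  | add x y hx hy => rw [map_add, hx, hy, map_add]
  | tmul h v =>
    change h • (tmul (M := regular H) (f.hom v) (1 : H) : tensorObj k W (regular H)) =
      (tensorHom k f (𝟙 (regular H))).hom (h • (tmul (M := regular H) v (1 : H)))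
    rw [map_smul]
    rfl

/-- A unit `u` with `∑ Λ₂u ⊗ S⁻¹(Λ₁) = ∑ Λ₁ ⊗ S(Λ₂)`. -/
def integralUnit : Hˣ := hΛ.exists_unit.choose

/-- The isomorphism `V ⊗ H ≅ H ⊗ V`. -/
def swapIso (V : ModuleCat.{u} H) : tensorObj k V (regular H) ≅ tensorObj k (regular H) V :=
  (freeIsoRight hΛ V).symm ≪≫ freeUnitIso (integralUnit hΛ) V ≪≫ freeIsoLeft k V

theorem swapIso_naturality {V W : ModuleCat.{u} H} (f : V ⟶ W) :
    tensorHom k f (𝟙 (regular H)) ≫ (swapIso hΛ W).hom =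
      (swapIso hΛ V).hom ≫ tensorHom k (𝟙 (regular H)) f := by
  simp only [swapIso, Iso.trans_hom, Iso.symm_hom, Category.assoc, ← freeIsoLeft_naturality]
  rw [← reassoc_of% freeUnitIso_naturality (integralUnit hΛ) f, ← cancel_epi (freeIsoRight hΛ V).hom,
    Iso.hom_inv_id_assoc, ← reassoc_of% freeIsoRight_naturality hΛ f, Iso.hom_inv_id_assoc]

/-- In free coordinates both sides come from elements of `H ⊗ H` acting on `v`, and the equation is
the defining property of the unit `u`. -/
theorem integralInclusionRight_swapIso (V : ModuleCat.{u} H) :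
    integralInclusionRight k hΛ V ≫ (swapIso hΛ V).hom = integralInclusion k hΛ V := by
  rw [← cancel_mono (freeIsoLeft k V).inv]
  simp only [swapIso, Iso.trans_hom, Iso.symm_hom, Category.assoc, Iso.hom_inv_id, Category.comp_id]
  refine ModuleCat.hom_ext (LinearMap.ext fun v => ?_)
  change (freeUnitIso (integralUnit hΛ) V).hom.hom
    ((orbitMap k v).lTensor H (comulAntipodeInv hΛ Λ)) =
      (orbitMap k v).lTensor H (comulAntipode k H Λ)
  rw [freeUnitIso_lTensor, integralUnit, hΛ.exists_unit.choose_spec]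

-- Extend linearly first, then average with the Casimir element `∑ Λ₁ ⊗ S(Λ₂)`. The Frobenius form
-- `l` recovers the original map on the submodule.
include hΛ in
theorem injective_freeObj (N : ModuleCat.{u} H) : Injective (freeObj k N) := by
  obtain ⟨l, hl⟩ := hΛ.exists_form
  refine ⟨fun {X Y} g i hi => ?_⟩
  obtain ⟨p, hp⟩ := LinearMap.exists_leftInverse_of_injective (kLin k i)
    (LinearMap.ker_eq_bot.2 ((ModuleCat.mono_iff_injective i).1 hi))
  let e : H ⊗[k] N →ₗ[k] N := (TensorProduct.lid k N).toLinearMap ∘ₗ l.rTensor N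
  let φ : Y →ₗ[k] N := e ∘ₗ (show X →ₗ[H] H ⊗[k] N from g.hom).restrictScalars k ∘ₗ p
  -- The extension is `y ↦ ∑ Λ₁ ⊗ φ(S(Λ₂)y)`; its `H`-linearity is the Casimir identity.
  let ext : Y →ₗ[H] H ⊗[k] N :=
    { toFun := fun y => φ.lTensor H ((orbitMap k y).lTensor H (comulAntipode k H Λ))
      map_add' := fun y y' => by
        have : orbitMap k (y + y') = orbitMap (A := H) k y + orbitMap k y' := by ext; simp
        rw [this, LinearMap.lTensor_add, LinearMap.add_apply, map_add]
      map_smul' := fun h y => by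
        rw [lTensor_orbitMap_smul, ← hΛ.casimir, RingHom.id_apply]
        generalize comulAntipode k H Λ = z
        induction z using TensorProduct.induction_on with
        | zero => simp
        | add x y hx hy => rw [mul_add, map_add, map_add, hx, hy, map_add, map_add, smul_add]
        | tmul a b => simp [TensorProduct.smul_tmul'] }
  refine ⟨ModuleCat.ofHom ext, ?_⟩
  -- The dual-basis identity `∑ l(S(Λ₂)y)Λ₁ = y`, tensored with `N`.
  have key : ∀ z : H ⊗[k] N, ∑ j ∈ (ℛ k Λ).index,
      (ℛ k Λ).left j ⊗ₜ[k] e (antipode k ((ℛ k Λ).right j) • z) = z := by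
    intro z
    induction z using TensorProduct.induction_on with
    | zero => simp
    | add x y hx hy =>
      simp only [smul_add, map_add, TensorProduct.tmul_add, Finset.sum_add_distrib]
      rw [hx, hy]
    | tmul y n =>
      conv_rhs => rw [← hΛ.sum_form_smul hl (ℛ k Λ) y]
      rw [TensorProduct.sum_tmul]
      refine Finset.sum_congr rfl fun j _ => ?_
      rw [TensorProduct.smul_tmul]
      rfl
  ext x
  refine Eq.trans ?_ (key (g.hom x))
  change φ.lTensor H ((orbitMap k (i.hom x)).lTensor H (comulAntipode k H Λ)) = _
  rw [comulAntipode_eq_sum k (ℛ k Λ), map_sum, map_sum]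
  refine Finset.sum_congr rfl fun j _ => ?_
  have h1 : φ (antipode k ((ℛ k Λ).right j) • i.hom x) =
      e (antipode k ((ℛ k Λ).right j) • g.hom x) := by
    rw [← map_smul, ← map_smul]
    exact congrArg (fun t => e (g.hom t)) (LinearMap.congr_fun hp _)
  exact congrArg (fun t => (ℛ k Λ).left j ⊗ₜ[k] t) h1

include hΛ in
theorem injective_tensorObj_regular (N : ModuleCat.{u} H) :
    Injective (tensorObj k (regular H) N) :=
  have := injective_freeObj hΛ N
  Injective.of_iso (freeIsoLeft k N) this

end Free

/-! ### Cones and shifts under tensor products -/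

section Shift

variable {k : Type u} {H : Type u} {A : Type u} [Field k] [Ring H] [HopfAlgebra k H]
  [Ring A] [Algebra k A] [LeftComoduleAlgebra k H A]

/-- `k → V → Q → 0` is exact, with first map `c ↦ c v₀`, and tensoring with `M` over `k` is right
exact. -/
theorem exists_tmul_of_tensorHom_eq_zero {V Q : ModuleCat.{u} H} (p : V ⟶ Q)
    (hp : Function.Surjective p.hom) (v₀ : V) (h₀ : p.hom v₀ = 0)
    (hv₀ : ∀ x : V, p.hom x = 0 → ∃ c : k, c • v₀ = x) {M : ModuleCat.{u} A}
    (y : tensorObj k V M) (hy : (tensorHom k p (𝟙 M)).hom y = 0) : ∃ m : M, tmul v₀ m = y := by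
  have hex : Function.Exact (LinearMap.toSpanSingleton k V v₀) (kLin k p) := by
    intro x
    refine ⟨fun hx => hv₀ x hx, ?_⟩
    rintro ⟨c, rfl⟩
    rw [LinearMap.toSpanSingleton_apply, map_smul]
    exact (congrArg (c • ·) h₀).trans (smul_zero c)
  obtain ⟨z, hz⟩ := (rTensor_exact (M : Type u) hex hp y).1 hy
  refine ⟨TensorProduct.lid k M z, ?_⟩
  rw [← hz]
  have : ∀ z : k ⊗[k] M, (v₀ ⊗ₜ[k] TensorProduct.lid k M z : V ⊗[k] M) =
      (LinearMap.toSpanSingleton k V v₀).rTensor M z := by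
    intro z
    induction z using TensorProduct.induction_on with
    | zero => simp
    | add x y hx hy => rw [map_add, TensorProduct.tmul_add, hx, hy, map_add]
    | tmul c m => simp [TensorProduct.smul_tmul]
  exact this z

variable {Λ : H} (hΛ : IsLeftIntegral k Λ)

/-- The complex `M → H ⊗ M → T M`. -/
def shiftComplex (M : ModuleCat.{u} A) : ShortComplex (ModuleCat.{u} A) :=
  ShortComplex.mk (integralInclusion k hΛ M) (shiftProj k Λ M) (integralInclusion_shiftProj k hΛ M)

instance epi_tensorHom_left {V Q : ModuleCat.{u} H} (p : V ⟶ Q) [Epi p] (M : ModuleCat.{u} A) :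
    Epi (tensorHom k p (𝟙 M)) :=
  inferInstanceAs (Epi ((tensorRightFunctor k H M).map p))

instance epi_tensorHom_right (V : ModuleCat.{u} H) {M N : ModuleCat.{u} A} (p : M ⟶ N) [Epi p] :
    Epi (tensorHom k (𝟙 V) p) :=
  inferInstanceAs (Epi ((tensorFunctor k V).map p))

instance epi_shiftProj (M : ModuleCat.{u} A) : Epi (shiftProj k Λ M) := by
  have : Epi (regularProj Λ) := (ModuleCat.epi_iff_surjective _).2 (Submodule.mkQ_surjective _)
  exact epi_tensorHom_left (regularProj Λ) M

instance (M : ModuleCat.{u} A) : Epi (shiftComplex hΛ M).g := epi_shiftProj M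

theorem shiftComplex_exact (M : ModuleCat.{u} A) : (shiftComplex hΛ M).Exact := by
  rw [ShortComplex.moduleCat_exact_iff]
  intro y hy
  refine exists_tmul_of_tensorHom_eq_zero (V := regular H) (regularProj Λ)
    (Submodule.mkQ_surjective _) Λ ?_ ?_ y hy
  · exact (Submodule.Quotient.mk_eq_zero _).2 (Submodule.mem_span_singleton_self Λ)
  · intro x hx
    obtain ⟨h, rfl⟩ := Submodule.mem_span_singleton.1 ((Submodule.Quotient.mk_eq_zero _).1 hx)
    -- The submodule `HΛ` is the line `kΛ`, since `hΛ = ε(h)Λ`.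
    exact ⟨Coalgebra.counit (R := k) h,
      (Algebra.smul_def (Coalgebra.counit (R := k) h) Λ).symm.trans (hΛ.mul_eq h).symm⟩

theorem shiftProj_naturality {M N : ModuleCat.{u} A} (f : M ⟶ N) :
    tensorHom k (𝟙 (regular H)) f ≫ shiftProj k Λ N =
      shiftProj k Λ M ≫ (shift k A Λ).map f :=
  tensor_ext fun _ _ => rfl

theorem tensorFunctor_map_exact (V : ModuleCat.{u} H) (M : ModuleCat.{u} A) :
    ((shiftComplex hΛ M).map (tensorFunctor k V)).Exact ∧
      Epi ((tensorFunctor k V).map (shiftComplex hΛ M).g) :=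
  have h : Limits.PreservesFiniteColimits (tensorFunctor k V : ModuleCat.{u} A ⥤ _) :=
    inferInstance
  have h' : ∀ S : ShortComplex (ModuleCat.{u} A), S.Exact ∧ Epi S.g →
      (S.map (tensorFunctor k V)).Exact ∧ Epi ((tensorFunctor k V).map S.g) :=
    ((Functor.preservesFiniteColimits_tfae (tensorFunctor k V)).out 3 1).1 h
  h' _ ⟨shiftComplex_exact hΛ M, inferInstance⟩

variable [FiniteDimensional k H]

/-- The isomorphism `V ⊗ (H ⊗ M) ≅ H ⊗ (V ⊗ M)`. -/
def tensorRegularIso (V : ModuleCat.{u} H) (M : ModuleCat.{u} A) :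
    tensorObj k V (tensorObj k (regular H) M) ≅ tensorObj k (regular H) (tensorObj k V M) :=
  (associator k V (regular H) M).symm ≪≫ tensorIso k (swapIso hΛ V) (Iso.refl M) ≪≫
    associator k (regular H) V M

/-- After reassociating, this is the compatibility of `r_V` with `Λ`, tensored with `M`. It is what
lets `V ⊗ -` commute with shifts and cones. -/
theorem integralInclusion_tensorRegularIso (V : ModuleCat.{u} H) (M : ModuleCat.{u} A) :
    tensorHom k (𝟙 V) (integralInclusion k hΛ M) ≫ (tensorRegularIso hΛ V M).hom =
      integralInclusion k hΛ (tensorObj k V M) := by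
  have h1 : tensorHom k (𝟙 V) (integralInclusion k hΛ M) =
      tensorHom k (integralInclusionRight k hΛ V) (𝟙 M) ≫ (associator k V (regular H) M).hom :=
    tensor_ext fun _ _ => rfl
  have h2 : tensorHom k (integralInclusion k hΛ V) (𝟙 M) ≫ (associator k (regular H) V M).hom =
      integralInclusion k hΛ (tensorObj k V M) :=
    tensor_ext fun _ _ => rfl
  rw [h1, tensorRegularIso, Iso.trans_hom, Iso.trans_hom, Iso.symm_hom, Category.assoc,
    Iso.hom_inv_id_assoc, tensorIso_hom, Iso.refl_hom, tensorHom_comp_assoc,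
    integralInclusionRight_swapIso, Category.comp_id, h2]

theorem tensorRegularIso_naturality (V : ModuleCat.{u} H) {M N : ModuleCat.{u} A} (f : M ⟶ N) :
    tensorHom k (𝟙 V) (tensorHom k (𝟙 (regular H)) f) ≫ (tensorRegularIso hΛ V N).hom =
      (tensorRegularIso hΛ V M).hom ≫ tensorHom k (𝟙 (regular H)) (tensorHom k (𝟙 V) f) := by
  simp only [tensorRegularIso, Iso.trans_hom, Iso.symm_hom, tensorIso_hom, Iso.refl_hom,
    Category.assoc, ← associator_naturality]
  rw [reassoc_of% associator_inv_naturality k (𝟙 V) (𝟙 (regular H)) f, tensorHom_comp_assoc, tensorHom_comp_assoc,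
    tensorHom_id, tensorHom_id, Category.comp_id, Category.id_comp, Category.comp_id,
    Category.id_comp]

/-- `V ⊗ T M` is still the cokernel of `V ⊗ M → V ⊗ (H ⊗ M)`, so `tensorRegularIso` descends to the
quotients. -/
theorem exists_shiftTensorHom (V : ModuleCat.{u} H) (M : ModuleCat.{u} A) :
    ∃ t : tensorObj k V ((shift k A Λ).obj M) ⟶ (shift k A Λ).obj (tensorObj k V M),
      tensorHom k (𝟙 V) (shiftProj k Λ M) ≫ t =
        (tensorRegularIso hΛ V M).hom ≫ shiftProj k Λ (tensorObj k V M) := by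
  have h := tensorFunctor_map_exact hΛ V M
  have : Epi ((shiftComplex hΛ M).map (tensorFunctor k V)).g := h.2
  refine ⟨h.1.desc ((tensorRegularIso hΛ V M).hom ≫ shiftProj k Λ (tensorObj k V M)) ?_,
    h.1.g_desc _ _⟩
  change tensorHom k (𝟙 V) (integralInclusion k hΛ M) ≫ _ ≫ _ = 0
  rw [reassoc_of% integralInclusion_tensorRegularIso hΛ V M, integralInclusion_shiftProj]

theorem exists_tensorShiftHom (V : ModuleCat.{u} H) (M : ModuleCat.{u} A) :
    ∃ t : (shift k A Λ).obj (tensorObj k V M) ⟶ tensorObj k V ((shift k A Λ).obj M),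
      shiftProj k Λ (tensorObj k V M) ≫ t =
        (tensorRegularIso hΛ V M).inv ≫ tensorHom k (𝟙 V) (shiftProj k Λ M) := by
  have h : integralInclusion k hΛ (tensorObj k V M) ≫ (tensorRegularIso hΛ V M).inv ≫
      tensorHom k (𝟙 V) (shiftProj k Λ M) = 0 := by
    rw [← integralInclusion_tensorRegularIso, Category.assoc, Iso.hom_inv_id_assoc, tensorHom_comp,
      integralInclusion_shiftProj]
    exact (tensorFunctor k V).map_zero _ _
  exact ⟨(shiftComplex_exact hΛ (tensorObj k V M)).desc ((tensorRegularIso hΛ V M).inv ≫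
    tensorHom k (𝟙 V) (shiftProj k Λ M)) h, (shiftComplex_exact hΛ _).g_desc _ h⟩

/-- The isomorphism `V ⊗ T M ≅ T (V ⊗ M)`. -/
def shiftTensorIso (V : ModuleCat.{u} H) (M : ModuleCat.{u} A) :
    tensorObj k V ((shift k A Λ).obj M) ≅ (shift k A Λ).obj (tensorObj k V M) where
  hom := (exists_shiftTensorHom hΛ V M).choose
  inv := (exists_tensorShiftHom hΛ V M).choose
  hom_inv_id := by
    rw [← cancel_epi (tensorHom k (𝟙 V) (shiftProj k Λ M)),
      reassoc_of% (exists_shiftTensorHom hΛ V M).choose_spec,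
      (exists_tensorShiftHom hΛ V M).choose_spec, Iso.hom_inv_id_assoc, Category.comp_id]
  inv_hom_id := by
    rw [← cancel_epi (shiftProj k Λ (tensorObj k V M)),
      reassoc_of% (exists_tensorShiftHom hΛ V M).choose_spec,
      (exists_shiftTensorHom hΛ V M).choose_spec, Iso.inv_hom_id_assoc, Category.comp_id]

theorem shiftProj_shiftTensorIso (V : ModuleCat.{u} H) (M : ModuleCat.{u} A) :
    tensorHom k (𝟙 V) (shiftProj k Λ M) ≫ (shiftTensorIso hΛ V M).hom =
      (tensorRegularIso hΛ V M).hom ≫ shiftProj k Λ (tensorObj k V M) :=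
  (exists_shiftTensorHom hΛ V M).choose_spec

theorem shiftTensorIso_naturality (V : ModuleCat.{u} H) {M N : ModuleCat.{u} A} (f : M ⟶ N) :
    tensorHom k (𝟙 V) ((shift k A Λ).map f) ≫ (shiftTensorIso hΛ V N).hom =
      (shiftTensorIso hΛ V M).hom ≫
        (shift k A Λ).map (tensorHom k (𝟙 V) f) := by
  rw [← cancel_epi (tensorHom k (𝟙 V) (shiftProj k Λ M))]
  have h1 : tensorHom k (𝟙 V) (shiftProj k Λ M) ≫
      tensorHom k (𝟙 V) ((shift k A Λ).map f) =
      tensorHom k (𝟙 V) (tensorHom k (𝟙 (regular H)) f) ≫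
        tensorHom k (𝟙 V) (shiftProj k Λ N) := by
    rw [tensorHom_comp, tensorHom_comp, shiftProj_naturality]
  rw [reassoc_of% h1, shiftProj_shiftTensorIso, reassoc_of% tensorRegularIso_naturality hΛ V f,
    shiftProj_naturality, reassoc_of% shiftProj_shiftTensorIso hΛ V M]

/-- The natural isomorphism `V ⊗ T M ≅ T (V ⊗ M)`. -/
def shiftTensorNatIso (A : Type u) [Ring A] [Algebra k A] [LeftComoduleAlgebra k H A]
    (V : ModuleCat.{u} H) :
    shift k A Λ ⋙ tensorFunctor k V ≅ tensorFunctor k V ⋙ shift k A Λ :=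
  NatIso.ofComponents (fun M => shiftTensorIso hΛ V M) fun f => shiftTensorIso_naturality hΛ V f

end Shift

/-! ### Cones under right exact functors -/

section Cone

variable {k : Type u} {H : Type u} {A B : Type u} [Field k] [Ring H] [HopfAlgebra k H]
  [Ring A] [Algebra k A] [LeftComoduleAlgebra k H A] [Ring B] [Algebra k B]
  [LeftComoduleAlgebra k H B] {Λ : H} (hΛ : IsLeftIntegral k Λ)

/-- The map `H ⊗ X → C_f`. -/
def coneInr {X Y : ModuleCat.{u} A} (f : X ⟶ Y) : tensorObj k (regular H) X ⟶ cone k hΛ f :=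
  Limits.pushout.inr f (integralInclusion k hΛ X)

theorem isPushout_cone {X Y : ModuleCat.{u} A} (f : X ⟶ Y) :
    IsPushout f (integralInclusion k hΛ X) (coneIn k hΛ f) (coneInr hΛ f) :=
  IsPushout.of_hasPushout f (integralInclusion k hΛ X)

theorem coneIn_coneOut {X Y : ModuleCat.{u} A} (f : X ⟶ Y) :
    coneIn k hΛ f ≫ coneOut k hΛ f = 0 :=
  Limits.pushout.inl_desc _ _ _

theorem coneInr_coneOut {X Y : ModuleCat.{u} A} (f : X ⟶ Y) :
    coneInr hΛ f ≫ coneOut k hΛ f = shiftProj k Λ X :=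
  Limits.pushout.inr_desc _ _ _

/-- `F` preserves the pushout square of the cone, and `e` identifies its corner `F(H ⊗ X)` with `H ⊗
F(X)`. The functor may change the algebra, so this covers tensoring in either variable. -/
theorem isPushout_map_cone (F : ModuleCat.{u} A ⥤ ModuleCat.{u} B)
    [Limits.PreservesFiniteColimits F] {X Y : ModuleCat.{u} A} (f : X ⟶ Y)
    (e : F.obj (tensorObj k (regular H) X) ≅ tensorObj k (regular H) (F.obj X))
    (he : F.map (integralInclusion k hΛ X) ≫ e.hom = integralInclusion k hΛ (F.obj X)) :
    IsPushout (F.map f) (integralInclusion k hΛ (F.obj X)) (F.map (coneIn k hΛ f))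
      (e.inv ≫ F.map (coneInr hΛ f)) :=
  ((isPushout_cone hΛ f).map F).of_iso (Iso.refl _) (Iso.refl _)
    e (Iso.refl _) (by simp) (by simp [he]) (by simp) (by simp)

/-- A right exact functor that commutes with `Λ ⊗ id` preserves cones. -/
def coneMapIso (F : ModuleCat.{u} A ⥤ ModuleCat.{u} B)
    [Limits.PreservesFiniteColimits F] {X Y : ModuleCat.{u} A} (f : X ⟶ Y)
    (e : F.obj (tensorObj k (regular H) X) ≅ tensorObj k (regular H) (F.obj X))
    (he : F.map (integralInclusion k hΛ X) ≫ e.hom = integralInclusion k hΛ (F.obj X)) :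
    F.obj (cone k hΛ f) ≅ cone k hΛ (F.map f) :=
  (isPushout_map_cone hΛ F f e he).isoPushout

end Cone

/-! ### Cones of tensored morphisms -/

section TensorCone

variable {k : Type u} {H : Type u} {A : Type u} [Field k] [Ring H] [HopfAlgebra k H]
  [Ring A] [Algebra k A] [LeftComoduleAlgebra k H A] {Λ : H} (hΛ : IsLeftIntegral k Λ)
  [FiniteDimensional k H]

/-- The isomorphism `V ⊗ C_f ≅ C_{V ⊗ f}`. -/
def tensorConeIso (V : ModuleCat.{u} H) {X Y : ModuleCat.{u} A} (f : X ⟶ Y) :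
    tensorObj k V (cone k hΛ f) ≅ cone k hΛ (tensorHom k (𝟙 V) f) :=
  coneMapIso hΛ (tensorFunctor k V) f (tensorRegularIso hΛ V X)
    (integralInclusion_tensorRegularIso hΛ V X)

theorem coneIn_tensorConeIso (V : ModuleCat.{u} H) {X Y : ModuleCat.{u} A} (f : X ⟶ Y) :
    tensorHom k (𝟙 V) (coneIn k hΛ f) ≫ (tensorConeIso hΛ V f).hom =
      coneIn k hΛ (tensorHom k (𝟙 V) f) :=
  (isPushout_map_cone hΛ (tensorFunctor k V) f (tensorRegularIso hΛ V X)
    (integralInclusion_tensorRegularIso hΛ V X)).inl_isoPushout_hom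

theorem coneInr_tensorConeIso (V : ModuleCat.{u} H) {X Y : ModuleCat.{u} A} (f : X ⟶ Y) :
    tensorHom k (𝟙 V) (coneInr hΛ f) ≫ (tensorConeIso hΛ V f).hom =
      (tensorRegularIso hΛ V X).hom ≫ coneInr hΛ (tensorHom k (𝟙 V) f) := by
  rw [← Iso.inv_comp_eq, ← Category.assoc]
  exact (isPushout_map_cone hΛ (tensorFunctor k V) f (tensorRegularIso hΛ V X)
    (integralInclusion_tensorRegularIso hΛ V X)).inr_isoPushout_hom

/-- Maps out of the pushout `V ⊗ C_f` are compared on its two legs: both vanish on `V ⊗ Y`, and on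
`V ⊗ (H ⊗ X)` the defining property of `shiftTensorIso` applies. -/
theorem coneOut_tensorConeIso (V : ModuleCat.{u} H) {X Y : ModuleCat.{u} A} (f : X ⟶ Y) :
    tensorHom k (𝟙 V) (coneOut k hΛ f) ≫ (shiftTensorIso hΛ V X).hom =
      (tensorConeIso hΛ V f).hom ≫ coneOut k hΛ (tensorHom k (𝟙 V) f) := by
  have h0 : tensorHom k (𝟙 V) (0 : Y ⟶ (shift k A Λ).obj X) = 0 :=
    (tensorFunctor k V).map_zero _ _
  refine ((isPushout_cone hΛ f).map (tensorFunctor k V)).hom_ext ?_ ?_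
  · change tensorHom k (𝟙 V) (coneIn k hΛ f) ≫ tensorHom k (𝟙 V) (coneOut k hΛ f) ≫ _ =
      tensorHom k (𝟙 V) (coneIn k hΛ f) ≫ _ ≫ _
    rw [reassoc_of% coneIn_tensorConeIso hΛ V f, tensorHom_comp_assoc, coneIn_coneOut,
      coneIn_coneOut, Category.comp_id, h0, Limits.zero_comp]
  · change tensorHom k (𝟙 V) (coneInr hΛ f) ≫ tensorHom k (𝟙 V) (coneOut k hΛ f) ≫ _ =
      tensorHom k (𝟙 V) (coneInr hΛ f) ≫ _ ≫ _
    rw [reassoc_of% coneInr_tensorConeIso hΛ V f, tensorHom_comp_assoc, coneInr_coneOut,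
      coneInr_coneOut, Category.comp_id, shiftProj_shiftTensorIso]

/-- The isomorphism `C_f ⊗ M ≅ C_{f ⊗ M}`. -/
def coneTensorIso {V W : ModuleCat.{u} H} (f : V ⟶ W) (M : ModuleCat.{u} A) :
    tensorObj k (cone k hΛ f) M ≅ cone k hΛ (tensorHom k f (𝟙 M)) :=
  coneMapIso hΛ (tensorRightFunctor k H M) f (associator k (regular H) V M)
    (tensor_ext fun _ _ => rfl)

end TensorCone

/-! ### Stable isomorphisms and distinguished triangles -/

section StableIso

variable {A : Type u} [Ring A] {S : ObjectProperty (ModuleCat.{u} A)}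

/-- `a` becomes an isomorphism in the stable category. -/
def StableIso (S : ObjectProperty (ModuleCat.{u} A)) {M N : ModuleCat.{u} A} (a : M ⟶ N) : Prop :=
  ∃ b : N ⟶ M, FactorsThrough S (a ≫ b - 𝟙 M) ∧ FactorsThrough S (b ≫ a - 𝟙 N)

/-- The quotient functor is full, so a stable inverse lifts to a module map. -/
theorem isIso_toStable_iff [Congruence (stableRel S)] {M N : ModuleCat.{u} A} (a : M ⟶ N) :
    IsIso ((toStable S).map a) ↔ StableIso S a := by
  constructor
  · rintro ⟨b, hb₁, hb₂⟩
    obtain ⟨b, rfl⟩ := (toStable S).map_surjective b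
    rw [← Functor.map_comp, ← CategoryTheory.Functor.map_id, CategoryTheory.Quotient.functor_map_eq_iff] at hb₁ hb₂
    exact ⟨b, hb₁, hb₂⟩
  · rintro ⟨b, hb₁, hb₂⟩
    refine ⟨(toStable S).map b, ?_, ?_⟩ <;>
      rw [← Functor.map_comp, ← CategoryTheory.Functor.map_id, CategoryTheory.Quotient.functor_map_eq_iff]
    exacts [hb₁, hb₂]

theorem StableIso.map {B : Type u} [Ring B] {S' : ObjectProperty (ModuleCat.{u} B)}
    (F : ModuleCat.{u} A ⥤ ModuleCat.{u} B) [F.Additive]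
    (hF : ∀ {M N : ModuleCat.{u} A} (f : M ⟶ N), FactorsThrough S f → FactorsThrough S' (F.map f))
    {M N : ModuleCat.{u} A} {a : M ⟶ N} (ha : StableIso S a) : StableIso S' (F.map a) := by
  obtain ⟨b, h₁, h₂⟩ := ha
  refine ⟨F.map b, ?_, ?_⟩
  · have := hF _ h₁
    rwa [F.map_sub, F.map_comp, F.map_id] at this
  · have := hF _ h₂
    rwa [F.map_sub, F.map_comp, F.map_id] at this

theorem StableIso.comp_iso {M N P : ModuleCat.{u} A} {a : M ⟶ N} (ha : StableIso S a) (e : N ≅ P) :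
    StableIso S (a ≫ e.hom) := by
  obtain ⟨b, h₁, Q, hQ, g₁, g₂, h₂⟩ := ha
  refine ⟨e.inv ≫ b, by simpa using h₁, Q, hQ, e.inv ≫ g₁, g₂ ≫ e.hom, ?_⟩
  rw [Category.assoc, reassoc_of% h₂]
  simp

theorem StableIso.mono {S' : ObjectProperty (ModuleCat.{u} A)}
    (h : ∀ {M N : ModuleCat.{u} A} (f : M ⟶ N), FactorsThrough S f → FactorsThrough S' f)
    {M N : ModuleCat.{u} A} {a : M ⟶ N} (ha : StableIso S a) : StableIso S' a := by
  obtain ⟨b, h₁, h₂⟩ := ha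
  exact ⟨b, h _ h₁, h _ h₂⟩

end StableIso

/-! ### Tensor products in the stable category -/

section Tensor

variable {k : Type u} {H : Type u} {A : Type u} [Field k] [Ring H] [HopfAlgebra k H]
  [Ring A] [Algebra k A] [LeftComoduleAlgebra k H A] {Λ : H} (hΛ : IsLeftIntegral k Λ)

theorem stableIso_of_iso {M N : ModuleCat.{u} A} (e : M ≅ N) :
    StableIso (induced k H A) e.hom := by
  refine ⟨e.inv, ?_, ?_⟩
  · rw [e.hom_inv_id, sub_self]; exact induced_zero k _ _
  · rw [e.inv_hom_id, sub_self]; exact induced_zero k _ _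

theorem factorsThrough_tensorRight {V W : ModuleCat.{u} H} {f : V ⟶ W} (M : ModuleCat.{u} A)
    (hf : FactorsThrough (induced k H H) f) :
    FactorsThrough (induced k H A) (tensorHom k f (𝟙 M)) := by
  obtain ⟨P, ⟨N, ⟨e⟩⟩, g₁, g₂, rfl⟩ := hf
  refine ⟨tensorObj k P M, ⟨tensorObj k N M, ⟨tensorIso k e (Iso.refl M) ≪≫
    associator k (regular H) N M⟩⟩, tensorHom k g₁ (𝟙 M), tensorHom k g₂ (𝟙 M), ?_⟩
  rw [tensorHom_comp, Category.comp_id]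

/-- A functional `f` with `f(Λ) ≠ 0` contracts `Λ ⊗ m` to the nonzero multiple `f(Λ)m`. -/
theorem mono_integralInclusion (M : ModuleCat.{u} A) : Mono (integralInclusion k hΛ M) := by
  obtain ⟨f, hf⟩ := not_forall.1 (mt (Module.forall_dual_apply_eq_zero_iff k Λ).1 hΛ.ne_zero)
  let B : H →ₗ[k] M →ₗ[k] M := (LinearMap.lsmul k M) ∘ₗ f
  let ρ : tensorObj k (regular H) M →+ M :=
    tensorLiftAddHom k (V := regular H) (LinearMap.toAddMonoidHom'.comp B.toAddMonoidHom)
      fun c x m => by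
        change f (algebraMap k H c * (x : H)) • m = f (x : H) • (c • m)
        rw [← Algebra.smul_def, map_smul, smul_eq_mul, mul_comm, mul_smul]
  rw [ModuleCat.mono_iff_injective]
  refine (injective_iff_map_eq_zero _).2 fun m hm => ?_
  have h : f Λ • m = 0 := (congrArg ρ hm).trans (map_zero ρ)
  exact (smul_eq_zero.1 h).resolve_left hf

variable [FiniteDimensional k H]

include hΛ

/-- `V ⊗ (H ⊗ X) ≅ H ⊗ (V ⊗ X)`, so `V ⊗ -` preserves induced modules. -/
theorem factorsThrough_tensorLeft (V : ModuleCat.{u} H) {M N : ModuleCat.{u} A} {f : M ⟶ N}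
    (hf : FactorsThrough (induced k H A) f) :
    FactorsThrough (induced k H A) (tensorHom k (𝟙 V) f) := by
  obtain ⟨P, ⟨X, ⟨e⟩⟩, g₁, g₂, rfl⟩ := hf
  refine ⟨tensorObj k V P, ⟨tensorObj k V X, ⟨tensorIso k (Iso.refl V) e ≪≫
    tensorRegularIso hΛ V X⟩⟩, tensorHom k (𝟙 V) g₁, tensorHom k (𝟙 V) g₂, ?_⟩
  rw [tensorHom_comp, Category.comp_id]

theorem stableIso_tensorLeft (V : ModuleCat.{u} H) {M N : ModuleCat.{u} A} {a : M ⟶ N}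
    (ha : StableIso (induced k H A) a) : StableIso (induced k H A) (tensorHom k (𝟙 V) a) :=
  ha.map (tensorFunctor k V) fun _ => factorsThrough_tensorLeft hΛ V

omit hΛ [FiniteDimensional k H] in
theorem stableIso_tensorRight {V W : ModuleCat.{u} H} {a : V ⟶ W}
    (ha : StableIso (induced k H H) a) (M : ModuleCat.{u} A) :
    StableIso (induced k H A) (tensorHom k a (𝟙 M)) :=
  ha.map (tensorRightFunctor k H M) fun _ => factorsThrough_tensorRight M

/-- The morphisms that factor through an injective module are the ones that factor through a module
`H ⊗ N`. -/
theorem factorsThrough_injectives_iff {V W : ModuleCat.{u} H} (f : V ⟶ W) :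
    FactorsThrough (injectives H) f ↔ FactorsThrough (induced k H H) f := by
  constructor
  · rintro ⟨Q, hQ, g₁, g₂, rfl⟩
    have : Injective Q := hQ
    have := mono_integralInclusion hΛ Q
    -- The monomorphism `Λ ⊗ id : Q → H ⊗ Q` splits because `Q` is injective, so a map through `Q`
    -- also passes through `H ⊗ Q`.
    refine ⟨tensorObj k (regular H) Q, ⟨Q, ⟨Iso.refl _⟩⟩, g₁ ≫ integralInclusion k hΛ Q,
      Injective.factorThru (𝟙 Q) (integralInclusion k hΛ Q) ≫ g₂, ?_⟩
    rw [Category.assoc, Injective.comp_factorThru_assoc, Category.id_comp]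
  · rintro ⟨P, ⟨N, ⟨e⟩⟩, g₁, g₂, rfl⟩
    exact ⟨P, Injective.of_iso e.symm (injective_tensorObj_regular hΛ N), g₁, g₂, rfl⟩

theorem tensorDescends (A : Type u) [Ring A] [Algebra k A] [LeftComoduleAlgebra k H A]
    (V : ModuleCat.{u} H) : TensorDescends k A V := by
  intro M N f g h
  refine (CategoryTheory.Quotient.functor_map_eq_iff (stableRel (induced k H A)) _ _).2 ?_
  have := factorsThrough_tensorLeft hΛ V h
  change FactorsThrough _ ((tensorFunctor k V).map (f - g)) at this
  rwa [Functor.map_sub] at this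

theorem stableTensor_additive (V : ModuleCat.{u} H) :
    (stableTensor k (tensorDescends hΛ A V)).Additive where
  map_add {X Y f g} := by
    obtain ⟨f, rfl⟩ := (toStable (induced k H A)).map_surjective f
    obtain ⟨g, rfl⟩ := (toStable (induced k H A)).map_surjective g
    exact congrArg (toStable (induced k H A)).map ((tensorFunctor k V).map_add (f := f) (g := g))

/-- Tensor the comparison with the standard triangle of `f`, then use `tensorConeIso` and
`shiftTensorIso` to identify the result with the standard triangle of `V ⊗ f`. -/
theorem IsDistinguished.tensor (V : ModuleCat.{u} H) {X Y Z : ModuleCat.{u} A}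
    {p : (toStable (induced k H A)).obj X ⟶ (toStable (induced k H A)).obj Y}
    {q : (toStable (induced k H A)).obj Y ⟶ (toStable (induced k H A)).obj Z}
    {r : (toStable (induced k H A)).obj Z ⟶ (toStable (induced k H A)).obj ((shift k A Λ).obj X)}
    (h : IsDistinguished k hΛ (induced k H A) p q r) :
    IsDistinguished k hΛ (induced k H A)
      (X := tensorObj k V X) (Y := tensorObj k V Y) (Z := tensorObj k V Z)
      ((stableTensor k (tensorDescends hΛ A V)).map p)
      ((stableTensor k (tensorDescends hΛ A V)).map q)
      ((stableTensor k (tensorDescends hΛ A V)).map r ≫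
        (toStable (induced k H A)).map (shiftTensorIso hΛ V X).hom) := by
  obtain ⟨X₀, Y₀, f, a, b, c, ha, hb, hc, h₁, h₂, h₃⟩ := h
  let F := stableTensor k (tensorDescends hΛ A V)
  let π := toStable (induced k H A)
  refine ⟨tensorObj k V X₀, tensorObj k V Y₀, tensorHom k (𝟙 V) f, tensorHom k (𝟙 V) a,
    tensorHom k (𝟙 V) b, tensorHom k (𝟙 V) c ≫ (tensorConeIso hΛ V f).hom, ?_, ?_, ?_, ?_, ?_, ?_⟩
  · exact inferInstanceAs (IsIso (F.map (π.map a)))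
  · exact inferInstanceAs (IsIso (F.map (π.map b)))
  · have : IsIso (π.map (tensorHom k (𝟙 V) c)) := inferInstanceAs (IsIso (F.map (π.map c)))
    rw [Functor.map_comp]
    infer_instance
  · have := congrArg F.map h₁
    rw [Functor.map_comp, Functor.map_comp] at this
    exact this
  · have h : ∀ q' : π.obj (tensorObj k V Y) ⟶ π.obj (tensorObj k V Z),
        q' ≫ π.map (tensorHom k (𝟙 V) c) =
          π.map (tensorHom k (𝟙 V) b) ≫ π.map (tensorHom k (𝟙 V) (coneIn k hΛ f)) →
        q' ≫ π.map (tensorHom k (𝟙 V) c ≫ (tensorConeIso hΛ V f).hom) =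
          π.map (tensorHom k (𝟙 V) b) ≫ π.map (coneIn k hΛ (tensorHom k (𝟙 V) f)) := by
      intro q' hq'
      rw [← coneIn_tensorConeIso, π.map_comp, π.map_comp, reassoc_of% hq']
    refine h _ ?_
    have := congrArg F.map h₂
    rw [Functor.map_comp, Functor.map_comp] at this
    exact this
  · have h : ∀ r' : π.obj (tensorObj k V Z) ⟶ π.obj (tensorObj k V ((shift k A Λ).obj X)),
        r' ≫ π.map (tensorHom k (𝟙 V) ((shift k A Λ).map a)) =
          π.map (tensorHom k (𝟙 V) c) ≫ π.map (tensorHom k (𝟙 V) (coneOut k hΛ f)) →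
        (r' ≫ π.map (shiftTensorIso hΛ V X).hom) ≫
            π.map ((shift k A Λ).map (tensorHom k (𝟙 V) a)) =
          π.map (tensorHom k (𝟙 V) c ≫ (tensorConeIso hΛ V f).hom) ≫
            π.map (coneOut k hΛ (tensorHom k (𝟙 V) f)) := by
      intro r' hr'
      rw [Category.assoc, ← π.map_comp, ← shiftTensorIso_naturality,
        ← π.map_comp (tensorHom k (𝟙 V) c ≫ _), Category.assoc, ← coneOut_tensorConeIso]
      simp only [π.map_comp]
      rw [reassoc_of% hr']
    refine h _ ?_
    have := congrArg F.map h₃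
    rw [Functor.map_comp, Functor.map_comp] at this
    exact this

end Tensor

/-! ### Grothendieck groups -/

section Grothendieck

variable {k : Type u} {H : Type u} {A : Type u} [Field k] [Ring H] [HopfAlgebra k H]
  [Ring A] [Algebra k A] [LeftComoduleAlgebra k H A] {Λ : H} (hΛ : IsLeftIntegral k Λ)

/-- The morphisms that factor through a module from `S` are the null-homotopic ones. -/
def IsNullHomotopyClass (k H : Type u) {A : Type u} [Field k] [Ring H] [HopfAlgebra k H] [Ring A]
    [Algebra k A] [LeftComoduleAlgebra k H A] (S : ObjectProperty (ModuleCat.{u} A)) : Prop :=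
  ∀ (M N : ModuleCat.{u} A) (f : M ⟶ N), FactorsThrough S f ↔ FactorsThrough (induced k H A) f

variable {S : ObjectProperty (ModuleCat.{u} A)} {P : ObjectProperty (ModuleCat.{u} A)}

theorem IsNullHomotopyClass.congruence (hS : IsNullHomotopyClass k H S) :
    Congruence (stableRel S) := by
  have : stableRel S = stableRel (induced k H A) := by
    funext M N f g
    exact propext (hS _ _ _)
  rw [this]
  infer_instance

theorem IsNullHomotopyClass.stableIso_iff (hS : IsNullHomotopyClass k H S) {M N : ModuleCat.{u} A}
    (a : M ⟶ N) : StableIso S a ↔ StableIso (induced k H A) a :=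
  ⟨fun h => h.mono fun f => (hS _ _ f).1, fun h => h.mono fun f => (hS _ _ f).2⟩

theorem IsNullHomotopyClass.isIso_iff (hS : IsNullHomotopyClass k H S) {M N : ModuleCat.{u} A}
    (a : M ⟶ N) : IsIso ((toStable S).map a) ↔ StableIso (induced k H A) a := by
  have := hS.congruence
  rw [isIso_toStable_iff, hS.stableIso_iff]

/-- Additive maps out of the Grothendieck group that agree on classes of modules are equal. -/
theorem GrothendieckGroup.induction {p : GrothendieckGroup k hΛ S P → Prop}
    (x : GrothendieckGroup k hΛ S P) (hcls : ∀ M, p (cls k hΛ S P M)) (h0 : p 0)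
    (hneg : ∀ x, p x → p (-x)) (hadd : ∀ x y, p x → p y → p (x + y)) : p x := by
  obtain ⟨x, rfl⟩ := QuotientAddGroup.mk_surjective x
  induction x using FreeAbelianGroup.induction_on with
  | zero => exact h0
  | of M => exact hcls M
  | neg M h => exact hneg _ h
  | add x y hx hy => exact hadd _ _ hx hy

/-- An additive invariant of triangles induces a map on the Grothendieck group. -/
def grothendieckLift (hS : IsNullHomotopyClass k H S) {G : Type*} [AddCommGroup G]
    (φ : P.FullSubcategory → G)
    (hφ : ∀ (X Y Z : P.FullSubcategory) (X₀ Y₀ : ModuleCat.{u} A) (f : X₀ ⟶ Y₀) (a : X.obj ⟶ X₀)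
      (b : Y.obj ⟶ Y₀) (c : Z.obj ⟶ cone k hΛ f), StableIso (induced k H A) a →
      StableIso (induced k H A) b → StableIso (induced k H A) c → φ Y = φ X + φ Z) :
    GrothendieckGroup k hΛ S P →+ G :=
  QuotientAddGroup.lift _ (FreeAbelianGroup.lift φ) (by
    rw [AddSubgroup.closure_le]
    rintro _ ⟨X, Y, Z, p, q, r, ⟨X₀, Y₀, f, a, b, c, ha, hb, hc, -⟩, rfl⟩
    have := hφ X Y Z X₀ Y₀ f a b c ((hS.isIso_iff a).1 ha) ((hS.isIso_iff b).1 hb)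
      ((hS.isIso_iff c).1 hc)
    simp [this])

theorem grothendieckLift_cls (hS : IsNullHomotopyClass k H S) {G : Type*} [AddCommGroup G]
    (φ : P.FullSubcategory → G) (hφ) (M : P.FullSubcategory) :
    grothendieckLift hΛ hS φ hφ (cls k hΛ S P M) = φ M :=
  FreeAbelianGroup.lift_apply_of φ M

/-- `Λ ⊗ id` is then a map between zero objects, and a pushout of an isomorphism is an isomorphism.
-/
theorem isIso_coneIn_of_isZero {X Y : ModuleCat.{u} A} (hX : Limits.IsZero X) (f : X ⟶ Y) :
    IsIso (coneIn k hΛ f) := by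
  have hX' : Limits.IsZero (tensorObj k (regular H) X) :=
    (tensorFunctor k (regular H)).map_isZero hX
  have : IsIso (integralInclusion k hΛ X) := ⟨0, hX.eq_of_src _ _, hX'.eq_of_src _ _⟩
  exact (isPushout_cone hΛ f).isIso_inl_of_isIso

variable [FiniteDimensional k H]

/-- The standard triangle of `f` can be transported back along the three stable isomorphisms, since
`T a` is stably invertible too. Only the vertices need comparing; `X₀`, `Y₀` and the cone need not
lie in `P`. -/
theorem cls_eq_add (hS : IsNullHomotopyClass k H S) (X Y Z : P.FullSubcategory)
    {X₀ Y₀ : ModuleCat.{u} A} (f : X₀ ⟶ Y₀) {a : X.obj ⟶ X₀} {b : Y.obj ⟶ Y₀}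
    {c : Z.obj ⟶ cone k hΛ f} (ha : StableIso (induced k H A) a)
    (hb : StableIso (induced k H A) b) (hc : StableIso (induced k H A) c) :
    cls k hΛ S P Y = cls k hΛ S P X + cls k hΛ S P Z := by
  have hTa : StableIso (induced k H A) ((shift k A Λ).map a) := stableIso_tensorLeft hΛ _ ha
  have ha' := (hS.isIso_iff a).2 ha
  have hb' := (hS.isIso_iff b).2 hb
  have hc' := (hS.isIso_iff c).2 hc
  have hTa' := (hS.isIso_iff _).2 hTa
  rw [← sub_eq_zero]
  refine (QuotientAddGroup.eq_zero_iff _).2 (AddSubgroup.subset_closure ?_)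
  let π := toStable S
  refine ⟨X, Y, Z, π.map a ≫ π.map f ≫ inv (π.map b),
    π.map b ≫ π.map (coneIn k hΛ f) ≫ inv (π.map c),
    π.map c ≫ π.map (coneOut k hΛ f) ≫ inv (π.map ((shift k A Λ).map a)),
    ⟨X₀, Y₀, f, a, b, c, ha', hb', hc', ?_, ?_, ?_⟩, rfl⟩
  · simp [π]
  · simp [π]
  · simp [π]

/-- The cone of `0 → M` is `M`, so `[M] = [0] + [N]` whenever `M ≅ N`. Comparing with the case `M =
N` gives the claim without first showing `[0] = 0`. -/
theorem cls_eq_of_iso (hS : IsNullHomotopyClass k H S) (h0 : P (ModuleCat.of A PUnit))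
    {M N : P.FullSubcategory} (e : M.obj ≅ N.obj) : cls k hΛ S P M = cls k hΛ S P N := by
  have key : ∀ {M N : P.FullSubcategory} (e : M.obj ≅ N.obj),
      cls k hΛ S P M = cls k hΛ S P ⟨_, h0⟩ + cls k hΛ S P N := by
    intro M N e
    have hZ : Limits.IsZero (ModuleCat.of A PUnit.{u + 1}) := ModuleCat.isZero_of_subsingleton _
    have := isIso_coneIn_of_isZero hΛ hZ (0 : ModuleCat.of A PUnit ⟶ M.obj)
    exact cls_eq_add hΛ hS ⟨_, h0⟩ M N (0 : ModuleCat.of A PUnit ⟶ M.obj)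
      (stableIso_of_iso (k := k) (H := H) (Iso.refl _))
      (stableIso_of_iso (k := k) (H := H) (Iso.refl _))
      (stableIso_of_iso (k := k) (H := H) (e.symm ≪≫ asIso (coneIn k hΛ _)))
  rw [key e, ← key (Iso.refl N.obj)]

variable (hP : ∀ V M, finDim k H V → P M → P (tensorObj k V M))

/-- For a finite-dimensional `H`-module `V`, the map `[M] ↦ [V ⊗ M]`. -/
def clsTensor (hS : IsNullHomotopyClass k H S) (V : (finDim k H).FullSubcategory) :
    GrothendieckGroup k hΛ S P →+ GrothendieckGroup k hΛ S P :=
  grothendieckLift hΛ hS (fun M => cls k hΛ S P ⟨tensorObj k V.obj M.obj, hP _ _ V.2 M.2⟩)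
    fun X Y Z _ _ f _ _ _ ha hb hc =>
      cls_eq_add hΛ hS ⟨tensorObj k V.obj X.obj, hP _ _ V.2 X.2⟩
        ⟨tensorObj k V.obj Y.obj, hP _ _ V.2 Y.2⟩ ⟨tensorObj k V.obj Z.obj, hP _ _ V.2 Z.2⟩
        (tensorHom k (𝟙 V.obj) f) (stableIso_tensorLeft hΛ V.obj ha)
        (stableIso_tensorLeft hΛ V.obj hb)
        ((stableIso_tensorLeft hΛ V.obj hc).comp_iso (tensorConeIso hΛ V.obj f))

theorem isNullHomotopyClass_injectives {Λ : H} (hΛ : IsLeftIntegral k Λ) :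
    IsNullHomotopyClass k H (injectives H) :=
  fun _ _ f => factorsThrough_injectives_iff hΛ f

/-- The pairing `[V] ⊗ [M] ↦ [V ⊗ M]`. -/
def tensorPairing (hS : IsNullHomotopyClass k H S) :
    KH k hΛ →+ GrothendieckGroup k hΛ S P →+ GrothendieckGroup k hΛ S P :=
  grothendieckLift hΛ (isNullHomotopyClass_injectives hΛ) (clsTensor hΛ hP hS) (by
    -- Additivity in the first variable, tested on generators `[M]`: `- ⊗ M` preserves stable
    -- isomorphisms and cones. This uses `(H ⊗ N) ⊗ M ≅ H ⊗ (N ⊗ M)` and no swap.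
    intro X Y Z X₀ Y₀ f a b c ha hb hc
    ext m
    induction m using GrothendieckGroup.induction with
    | h0 => simp
    | hneg x hx => rw [map_neg, map_neg, hx]
    | hadd x y hx hy => rw [map_add, map_add, hx, hy]
    | hcls M =>
      rw [AddMonoidHom.add_apply]
      simp only [clsTensor, grothendieckLift_cls]
      exact cls_eq_add hΛ hS ⟨tensorObj k X.obj M.obj, hP _ _ X.2 M.2⟩
        ⟨tensorObj k Y.obj M.obj, hP _ _ Y.2 M.2⟩ ⟨tensorObj k Z.obj M.obj, hP _ _ Z.2 M.2⟩
        (tensorHom k f (𝟙 M.obj)) (stableIso_tensorRight ha M.obj)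
        (stableIso_tensorRight hb M.obj)
        ((stableIso_tensorRight hc M.obj).comp_iso (coneTensorIso hΛ f M.obj)))

theorem tensorPairing_cls (hS : IsNullHomotopyClass k H S) (V : (finDim k H).FullSubcategory)
    (M : P.FullSubcategory) :
    tensorPairing hΛ hP hS (clsH k hΛ V) (cls k hΛ S P M) =
      cls k hΛ S P ⟨tensorObj k V.obj M.obj, hP _ _ V.2 M.2⟩ := by
  rw [tensorPairing, grothendieckLift_cls, clsTensor, grothendieckLift_cls]

/-- The product `[V][W] = [V ⊗ W]` on `K(H-mod)`. -/
def tensorProduct : KH k hΛ →+ KH k hΛ →+ KH k hΛ :=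
  tensorPairing hΛ (fun _ _ hV hW => finDim_tensorObj k hV hW) (isNullHomotopyClass_injectives hΛ)

theorem tensorProduct_cls (V W : (finDim k H).FullSubcategory) :
    tensorProduct hΛ (clsH k hΛ V) (clsH k hΛ W) =
      clsH k hΛ ⟨tensorObj k V.obj W.obj, finDim_tensorObj k V.2 W.2⟩ :=
  tensorPairing_cls hΛ _ _ V W

theorem tensorPairing_assoc (hS : IsNullHomotopyClass k H S) (h0 : ∀ M, P M → P (ModuleCat.of A PUnit))
    (x y : KH k hΛ) (m : GrothendieckGroup k hΛ S P) :
    tensorPairing hΛ hP hS (tensorProduct hΛ x y) m =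
      tensorPairing hΛ hP hS x (tensorPairing hΛ hP hS y m) := by
  induction x using GrothendieckGroup.induction with
  | h0 => simp
  | hneg x hx => simp only [map_neg, AddMonoidHom.neg_apply, hx]
  | hadd x y hx hy => simp only [map_add, AddMonoidHom.add_apply, hx, hy]
  | hcls V =>
    induction y using GrothendieckGroup.induction with
    | h0 => simp
    | hneg x hx => simp only [map_neg, AddMonoidHom.neg_apply, hx]
    | hadd x y hx hy => simp only [map_add, AddMonoidHom.add_apply, hx, hy]
    | hcls W =>
      induction m using GrothendieckGroup.induction with
      | h0 => simp
      | hneg x hx => simp only [map_neg, hx]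
      | hadd x y hx hy => simp only [map_add, hx, hy]
      | hcls M =>
        rw [tensorProduct_cls, tensorPairing_cls, tensorPairing_cls, tensorPairing_cls]
        exact cls_eq_of_iso hΛ hS (h0 _ M.2) (associator k V.obj W.obj M.obj)

end Grothendieck

/-! ### The trivial module as unit -/

section Unit

variable {k : Type u} {H : Type u} {A : Type u} [Field k] [Ring H] [HopfAlgebra k H]
  [Ring A] [Algebra k A] [LeftComoduleAlgebra k H A]

/-- The basis vector of the trivial module. -/
def trivialOne (k H : Type u) [Field k] [Ring H] [HopfAlgebra k H] : trivialModule k H := (1 : k)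

/-- The trivial module is `k`. -/
def trivialVal (k H : Type u) [Field k] [Ring H] [HopfAlgebra k H] : trivialModule k H →+ k :=
  AddMonoidHom.id k

theorem trivialVal_smul (c : k) (x : trivialModule k H) :
    trivialVal k H (algebraMap k H c • x) = c * trivialVal k H x := by
  change Coalgebra.counit (R := k) (algebraMap k H c) * trivialVal k H x = _
  rw [Bialgebra.counit_algebraMap]

theorem smul_trivialOne (x : trivialModule k H) :
    algebraMap k H (trivialVal k H x) • trivialOne k H = x :=
  (trivialVal_smul (k := k) (H := H) _ _).trans (mul_one (trivialVal k H x))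

theorem counit_smul_trivialModule (h : H) (x : trivialModule k H) :
    algebraMap k H (Coalgebra.counit (R := k) h) • x = h • x :=
  trivialVal_smul (k := k) (H := H) _ x

/-- The map `m ↦ 1 ⊗ m`. -/
def leftUnitorInv (M : ModuleCat.{u} A) : M ⟶ tensorObj k (trivialModule k H) M :=
  ModuleCat.ofHom (R := A) (X := M) (Y := tensorObj k (trivialModule k H) M)
    { toFun := fun m => tmul (trivialOne k H) m
      map_add' := fun m m' => tmul_add k (trivialOne k H) m m'
      map_smul' := fun a m => by
        obtain ⟨s, hs⟩ := TensorProduct.exists_finset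
          (LeftComoduleAlgebra.coact (k := k) (H := H) a)
        have h1 := LeftComoduleAlgebra.counit_coact (k := k) (H := H) a
        rw [hs] at h1
        simp only [map_sum, LinearMap.rTensor_tmul, TensorProduct.lid_tmul] at h1
        rw [RingHom.id_apply, tensorObj_smul_tmul a s Prod.fst Prod.snd hs]
        conv_lhs => rw [← h1, Finset.sum_smul, tmul_sum]
        refine Finset.sum_congr rfl fun i _ => ?_
        rw [Algebra.smul_def, mul_smul, ← smul_tmul, counit_smul_trivialModule] }

instance (M : ModuleCat.{u} A) : IsIso (leftUnitorInv (k := k) (H := H) M) := by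
  rw [ConcreteCategory.isIso_iff_bijective]
  let B : trivialModule k H →+ M →+ M := (LinearMap.toAddMonoidHom'.comp
    (LinearMap.lsmul k M).toAddMonoidHom).comp (trivialVal k H)
  let ρ : tensorObj k (trivialModule k H) M →+ M :=
    tensorLiftAddHom k B fun c x m => by
        change trivialVal k H (algebraMap k H c • x) • m = trivialVal k H x • (c • m)
        rw [trivialVal_smul, mul_comm, mul_smul]
  refine Function.bijective_iff_has_inverse.2 ⟨ρ, fun m => one_smul k m, fun x => ?_⟩
  refine tensor_addHom_ext (f := (leftUnitorInv (k := k) (H := H) M).hom.toAddMonoidHom.comp ρ)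
    (g := AddMonoidHom.id _) (fun c m => ?_) x
  change tmul (trivialOne k H) (algebraMap k A (trivialVal k H c) • m) = tmul c m
  rw [← smul_tmul, smul_trivialOne]

/-- The map `v ↦ v ⊗ 1`. -/
def rightUnitorInv (V : ModuleCat.{u} H) : V ⟶ tensorObj k V (trivialModule k H) :=
  ModuleCat.ofHom (R := H) (X := V) (Y := tensorObj k V (trivialModule k H))
    { toFun := fun v => tmul v (trivialOne k H)
      map_add' := fun v v' => add_tmul k v v' (trivialOne k H)
      map_smul' := fun a v => by
        obtain ⟨s, hs⟩ := TensorProduct.exists_finset (Coalgebra.comul (R := k) a)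
        have h1 := congrArg (TensorProduct.rid k H) (Coalgebra.lTensor_counit_comul (R := k) a)
        rw [hs] at h1
        simp only [map_sum, LinearMap.lTensor_tmul, TensorProduct.rid_tmul, one_smul] at h1
        rw [RingHom.id_apply, tensorObj_smul_tmul a s Prod.fst Prod.snd hs]
        conv_lhs => rw [← h1, Finset.sum_smul, sum_tmul]
        refine Finset.sum_congr rfl fun i _ => ?_
        rw [Algebra.smul_def, mul_smul, smul_tmul, counit_smul_trivialModule] }

instance (V : ModuleCat.{u} H) : IsIso (rightUnitorInv (k := k) V) := by
  rw [ConcreteCategory.isIso_iff_bijective]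
  let B : trivialModule k H →+ V →+ V := (LinearMap.toAddMonoidHom'.comp
    (LinearMap.lsmul k V).toAddMonoidHom).comp (trivialVal k H)
  let ρ : tensorObj k V (trivialModule k H) →+ V :=
    tensorLiftAddHom k B.flip fun c v x => by
        change trivialVal k H x • (c • v) = trivialVal k H (algebraMap k H c • x) • v
        rw [trivialVal_smul, mul_comm, mul_smul]
  refine Function.bijective_iff_has_inverse.2 ⟨ρ, fun m => one_smul k m, fun x => ?_⟩
  refine tensor_addHom_ext (f := (rightUnitorInv (k := k) V).hom.toAddMonoidHom.comp ρ)
    (g := AddMonoidHom.id _) (fun v c => ?_) x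
  change tmul (algebraMap k H (trivialVal k H c) • v) (trivialOne k H) = tmul v c
  rw [smul_tmul, smul_trivialOne]

end Unit

/-! ### Stability of the class `P` under tensoring -/

section Closure

variable {k : Type u} {H : Type u} {A : Type u} [Field k] [Ring H] [HopfAlgebra k H]
  [Ring A] [Algebra k A] [LeftComoduleAlgebra k H A] {P : ObjectProperty (ModuleCat.{u} A)}

theorem prop_punit [P.IsClosedUnderSubobjects] {M : ModuleCat.{u} A} (hM : P M) :
    P (ModuleCat.of A PUnit) := by
  have : Mono (0 : ModuleCat.of A PUnit.{u + 1} ⟶ M) :=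
    (ModuleCat.mono_iff_injective _).2 (Function.injective_of_subsingleton _)
  exact P.prop_of_mono (0 : ModuleCat.of A PUnit.{u + 1} ⟶ M) hM

/-- If `V₁` and `V₂` together span `U`, then `U ⊗ M` is a quotient of `(V₁ ⊗ M) × (V₂ ⊗ M)`. -/
theorem prop_tensorObj_of_surjective [P.IsClosedUnderQuotients]
    (hprod : ∀ M N : ModuleCat.{u} A, P M → P N → P (ModuleCat.of A (M × N)))
    {V₁ V₂ U : ModuleCat.{u} H} {M : ModuleCat.{u} A} (f : V₁ ⟶ U) (g : V₂ ⟶ U)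
    (hfg : ∀ u : U, ∃ v w, f.hom v + g.hom w = u) (h₁ : P (tensorObj k V₁ M))
    (h₂ : P (tensorObj k V₂ M)) : P (tensorObj k U M) := by
  let φ : ModuleCat.of A (tensorObj k V₁ M × tensorObj k V₂ M) ⟶ tensorObj k U M :=
    ModuleCat.ofHom (R := A) (X := tensorObj k V₁ M × tensorObj k V₂ M) (Y := tensorObj k U M)
      ((tensorHom k f (𝟙 M)).hom.coprod (tensorHom k g (𝟙 M)).hom)
  have : Epi φ := by
    rw [ModuleCat.epi_iff_surjective]
    intro x
    refine TensorProduct.induction_on (motive := fun x : U ⊗[k] M => ∃ y, φ.hom y = x) x ?_ ?_ ?_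
    · exact ⟨0, map_zero φ.hom⟩
    · intro u m
      obtain ⟨v, w, rfl⟩ := hfg u
      exact ⟨(tmul v m, tmul w m), (add_tmul k (f.hom v) (g.hom w) m).symm⟩
    · rintro _ _ ⟨y, rfl⟩ ⟨z, rfl⟩
      exact ⟨y + z, map_add φ.hom y z⟩
  exact P.prop_of_epi φ (hprod _ _ h₁ h₂)

/-- Induction over finitely generated submodules of `V`: a cyclic one is a quotient of `H`, where
`hreg` applies, and sums are covered by `prop_tensorObj_of_surjective`. -/
theorem prop_tensorObj [P.IsClosedUnderSubobjects] [P.IsClosedUnderQuotients]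
    (hprod : ∀ M N : ModuleCat.{u} A, P M → P N → P (ModuleCat.of A (M × N)))
    (hreg : ∀ M : ModuleCat.{u} A, P M → P (tensorObj k (regular H) M))
    (V : ModuleCat.{u} H) (M : ModuleCat.{u} A) (hV : finDim k H V) (hM : P M) :
    P (tensorObj k V M) := by
  have : FiniteDimensional k V := hV
  have hfin : Module.Finite H V := Module.Finite.of_restrictScalars_finite k H V
  have key : ∀ N : Submodule H V, N.FG → P (tensorObj k (ModuleCat.of H N) M) := by
    intro N hN
    refine Submodule.fg_induction
      (motive := fun (N : Submodule H V) _ => P (tensorObj k (ModuleCat.of H N) M)) ?_ ?_ N hN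
    · intro x
      let p : regular H ⟶ ModuleCat.of H (Submodule.span H {x}) :=
        ModuleCat.ofHom ((LinearMap.toSpanSingleton H V x).codRestrict _ fun h =>
          Submodule.smul_mem _ h (Submodule.mem_span_singleton_self x))
      have hp : Epi p := by
        rw [ModuleCat.epi_iff_surjective]
        rintro ⟨y, hy⟩
        obtain ⟨h, rfl⟩ := Submodule.mem_span_singleton.1 hy
        exact ⟨h, rfl⟩
      exact P.prop_of_epi (tensorHom k p (𝟙 M)) (hreg M hM)
    · intro N₁ N₂ _ _ h₁ h₂
      refine prop_tensorObj_of_surjective hprod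
        (ModuleCat.ofHom (Submodule.inclusion (le_sup_left : N₁ ≤ N₁ ⊔ N₂)))
        (ModuleCat.ofHom (Submodule.inclusion (le_sup_right : N₂ ≤ N₁ ⊔ N₂))) ?_ h₁ h₂
      rintro ⟨y, hy⟩
      obtain ⟨a, ha, b, hb, rfl⟩ := Submodule.mem_sup.1 hy
      exact ⟨⟨a, ha⟩, ⟨b, hb⟩, rfl⟩
  let e : ModuleCat.of H (⊤ : Submodule H V) ≅ V :=
    (Submodule.topEquiv (R := H) (M := V)).toModuleIso
  exact P.prop_of_epi (tensorIso k e (Iso.refl M)).hom (key ⊤ hfin.1)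

theorem finDim_punit : finDim k H (ModuleCat.of H PUnit) := by
  have : Subsingleton (ModuleCat.of H PUnit.{u + 1}) := inferInstanceAs (Subsingleton PUnit)
  exact Module.Finite.of_surjective (0 : k →ₗ[k] ModuleCat.of H PUnit.{u + 1})
    (Function.surjective_to_subsingleton _)

end Closure

/-! ### The ring `K(H-mod)` and its modules -/

section Ring

variable {k : Type u} {H : Type u} {A : Type u} [Field k] [Ring H] [HopfAlgebra k H]
  [FiniteDimensional k H] [Ring A] [Algebra k A] [LeftComoduleAlgebra k H A] {Λ : H}
  (hΛ : IsLeftIntegral k Λ) {S P : ObjectProperty (ModuleCat.{u} A)}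
  (hP : ∀ V M, finDim k H V → P M → P (tensorObj k V M))

theorem tensorPairing_one (hS : IsNullHomotopyClass k H S) (h0 : ∀ M, P M → P (ModuleCat.of A PUnit))
    (m : GrothendieckGroup k hΛ S P) :
    tensorPairing hΛ hP hS (clsH k hΛ ⟨trivialModule k H, finDim_trivialModule k⟩) m = m := by
  induction m using GrothendieckGroup.induction with
  | h0 => simp
  | hneg x hx => rw [map_neg, hx]
  | hadd x y hx hy => rw [map_add, hx, hy]
  | hcls M =>
    rw [tensorPairing_cls]
    exact cls_eq_of_iso hΛ hS (h0 _ M.2) (asIso (leftUnitorInv (k := k) (H := H) M.obj)).symm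

theorem tensorProduct_one (x : KH k hΛ) :
    tensorProduct hΛ x (clsH k hΛ ⟨trivialModule k H, finDim_trivialModule k⟩) = x := by
  induction x using GrothendieckGroup.induction with
  | h0 => simp
  | hneg x hx => rw [map_neg, AddMonoidHom.neg_apply, hx]
  | hadd x y hx hy => rw [map_add, AddMonoidHom.add_apply, hx, hy]
  | hcls V =>
    rw [tensorProduct_cls]
    exact cls_eq_of_iso hΛ (isNullHomotopyClass_injectives hΛ) finDim_punit
      (asIso (rightUnitorInv (k := k) V.obj)).symm

/-- The ring `K(H-mod)`. -/
abbrev grothendieckRing : Ring (KH k hΛ) :=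
  { grothendieckAddCommGroup k hΛ (injectives H) (finDim k H) with
    mul := fun x y => tensorProduct hΛ x y
    one := clsH k hΛ ⟨trivialModule k H, finDim_trivialModule k⟩
    left_distrib := fun x y z => map_add (tensorProduct hΛ x) y z
    right_distrib := fun x y z => by
      change tensorProduct hΛ (x + y) z = tensorProduct hΛ x z + tensorProduct hΛ y z
      rw [map_add, AddMonoidHom.add_apply]
    zero_mul := fun x => by
      change tensorProduct hΛ 0 x = 0
      rw [map_zero, AddMonoidHom.zero_apply]
    mul_zero := fun x => map_zero (tensorProduct hΛ x)
    mul_assoc := fun x y z => tensorPairing_assoc hΛ _ _ (fun _ _ => finDim_punit) x y z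
    one_mul := fun x => tensorPairing_one hΛ _ _ (fun _ _ => finDim_punit) x
    mul_one := fun x => tensorProduct_one hΛ x }

/-- The `K(H-mod)`-module structure on the Grothendieck group of a class of `A`-modules. -/
abbrev grothendieckModule (hS : IsNullHomotopyClass k H S) (h0 : ∀ M, P M → P (ModuleCat.of A PUnit)) :
    @Module (KH k hΛ) (GrothendieckGroup k hΛ S P) (grothendieckRing hΛ).toSemiring
      (grothendieckAddCommGroup k hΛ S P).toAddCommMonoid :=
  letI := grothendieckRing hΛ
  { smul := fun x m => tensorPairing hΛ hP hS x m
    one_smul := fun m => tensorPairing_one hΛ hP hS h0 m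
    mul_smul := fun x y m => tensorPairing_assoc hΛ hP hS h0 x y m
    smul_zero := fun x => map_zero (tensorPairing hΛ hP hS x)
    smul_add := fun x m n => map_add (tensorPairing hΛ hP hS x) m n
    add_smul := fun x y m => by
      change tensorPairing hΛ hP hS (x + y) m = tensorPairing hΛ hP hS x m +
        tensorPairing hΛ hP hS y m
      rw [map_add, AddMonoidHom.add_apply]
    zero_smul := fun m => by
      change tensorPairing hΛ hP hS 0 m = 0
      rw [map_zero, AddMonoidHom.zero_apply] }

end Ring

end

end Hopfological

theorem mainTheorem9 (k H A : Type u) [Field k] [Ring H] [HopfAlgebra k H] [FiniteDimensional k H]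
    [Ring A] [Algebra k A] [LeftComoduleAlgebra k H A]
    (Λ : H) (hΛ : IsLeftIntegral k Λ) :
    (∃ r : ∀ V : ModuleCat.{u} H, tensorObj k V (regular H) ≅ tensorObj k (regular H) V,
      (∀ (V W : ModuleCat.{u} H) (f : V ⟶ W),
        tensorHom k f (𝟙 (regular H)) ≫ (r W).hom = (r V).hom ≫ tensorHom k (𝟙 (regular H)) f) ∧
      (∀ V : ModuleCat.{u} H,
        integralInclusionRight k hΛ V ≫ (r V).hom = integralInclusion k hΛ V)) ∧
    (∀ V : ModuleCat.{u} H, ∃ hV : TensorDescends k A V,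
      (stableTensor k hV).Additive ∧
      ∃ θ : shift k A Λ ⋙ tensorFunctor k V ≅ tensorFunctor k V ⋙ shift k A Λ,
        ∀ (X Y Z : ModuleCat.{u} A)
          (p : (toStable (induced k H A)).obj X ⟶ (toStable (induced k H A)).obj Y)
          (q : (toStable (induced k H A)).obj Y ⟶ (toStable (induced k H A)).obj Z)
          (r : (toStable (induced k H A)).obj Z ⟶
            (toStable (induced k H A)).obj ((shift k A Λ).obj X)),
          IsDistinguished k hΛ (induced k H A) p q r →
            IsDistinguished k hΛ (induced k H A)
              (X := tensorObj k V X) (Y := tensorObj k V Y) (Z := tensorObj k V Z)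
              ((stableTensor k hV).map p) ((stableTensor k hV).map q)
              ((stableTensor k hV).map r ≫ (toStable (induced k H A)).map (θ.hom.app X))) ∧
    (∃ R : Ring (KH k hΛ),
      R.toAddCommGroup = grothendieckAddCommGroup k hΛ (injectives H) (finDim k H) ∧
      R.one = clsH k hΛ ⟨trivialModule k H, finDim_trivialModule k⟩ ∧
      (∀ V W : (finDim k H).FullSubcategory,
        R.mul (clsH k hΛ V) (clsH k hΛ W) =
          clsH k hΛ ⟨tensorObj k V.obj W.obj, finDim_tensorObj k V.property W.property⟩) ∧
      ∀ (P : ObjectProperty (ModuleCat.{u} A)) [P.IsClosedUnderSubobjects]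
        [P.IsClosedUnderQuotients],
        (∀ M N : ModuleCat.{u} A, P M → P N → P (ModuleCat.of A (M × N))) →
        (∀ M : ModuleCat.{u} A, P M → P (tensorObj k (regular H) M)) →
        ∃ act : @Module (KH k hΛ) (KA k hΛ P) R.toSemiring
            (grothendieckAddCommGroup k hΛ (induced k H A) P).toAddCommMonoid,
          ∀ (V : (finDim k H).FullSubcategory) (M : P.FullSubcategory),
            ∃ hVM : P (tensorObj k V.obj M.obj),
              act.smul (clsH k hΛ V) (clsA k hΛ P M) =
                clsA k hΛ P ⟨tensorObj k V.obj M.obj, hVM⟩) := by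
  refine ⟨⟨swapIso hΛ, fun V W f => swapIso_naturality hΛ f, integralInclusionRight_swapIso hΛ⟩,
    fun V => ⟨tensorDescends hΛ A V, stableTensor_additive hΛ V, shiftTensorNatIso hΛ A V,
      fun X Y Z p q r h => h.tensor hΛ V⟩,
    grothendieckRing hΛ, rfl, rfl, fun V W => tensorProduct_cls hΛ V W, ?_⟩
  intro P _ _ hprod hreg
  have hP : ∀ V M, finDim k H V → P M → P (tensorObj k V M) := prop_tensorObj hprod hreg
  -- For `A`-modules the ideal is the null-homotopic one by definition; only the ring needed the
  -- comparison with injectives.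
  have hS : IsNullHomotopyClass k H (induced k H A) := fun _ _ _ => Iff.rfl
  exact ⟨grothendieckModule hΛ hP hS fun _ hM => prop_punit hM,
    fun V M => ⟨hP _ _ V.2 M.2, tensorPairing_cls hΛ hP hS V M⟩⟩
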